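/- Let $\Phi$ be the standard normal law. For a sequence $\{G_n\}$ of probability laws on $\mathbb R$ and $\beta\in[0,1]$ put $\pi_n=n^{-\beta}$, $H_0^n=\Phi^{\otimes n}$ and $H_1^n=\big((1-\pi_n)\Phi+\pi_n\,(G_n*\Phi)\big)^{\otimes n}$; $H_1^n$ is the law of $X\in\mathbb R^n$ with independent $X_i\sim N(\mu_i,1)$, where $\mu_i\overset{iid}\sim(1-\pi_n)\delta_0+\pi_nG_n$. Let $d_{TV}(P,Q)=\sup_A|P(A)-Q(A)|$. The sequence $\{G_n\}$ has critical sparsity level $\beta^*$ if $$\sup\{\beta\in[0,1]:\ d_{TV}(H_0^n,H_1^n)\to1\}=\inf\{\beta\in[0,1]:\ d_{TV}(H_0^n,H_1^n)\to0\}=\beta^*,$$ where supremum and infimum are taken in $[0,1]$ (so $\sup\emptyset=0$ and $\inf\emptyset=1$). The level-$\alpha$ max test rejects when $\max_i|X_i|$ exceeds its $1-\alpha$ quantile under $H_0^n$. It attains the critical sparsity level $\beta^*$ if, for all $\beta\in[0,\beta^*)$ and all $\alpha\in(0,1)$, its rejection probability under $H_1^n$ tends to $1$. Let $G$ be a probability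 law on $\mathbb R$ with density $g$, and let $G_n(\mu)=G(\mu/\sigma_n)$, i.e. $G_n$ is the law of $\sigma_n\theta$ with $\theta\sim G$. All asymptotic relations for $g$ are as $\theta\to+\infty$. 1. If $g(\theta)=\Theta(\theta^{-\nu-1})$ and $g(-\theta)=O(\theta^{-\nu-1})$ for some $\nu>0$, and $\sigma_n\sim n^\rho$ (the ratio tends to $1$) with $\rho>-\frac1{2\nu}$, then $\{G_n\}$ has critical sparsity level $\beta^*=\min\{\nu\rho+1,\,1\}$ (so $\beta^*=\nu\rho+1$ for $\rho\le0$). 2. If $g(\theta)=\Theta(e^{-\theta})$ and $g(-\theta)=O(e^{-\theta})$, and $\sigma_n=r(2\log n)^{-1/2}$ with $r>\sqrt2/(\sqrt2-1)$, then $\{G_n\}$ has critical sparsity level $\beta^*=(1-1/r)^2$. 3. If $g(\theta)=\Theta(e^{-(\theta-\gamma)^2/2})$ and $g(-\theta)=O(e^{-(\theta-\gamma')^2/2})$ for some $\gamma,\gamma'\in\mathbb R$, and $\sigma_n=r$ with $r>1$, then $\{G_n\}$ has critical sparsity level $\beta^*=\dfrac{r^2}{r^2+1}$. In all three cases the max test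 attains the critical sparsity level $\beta^*$. -/

import Mathlib

open MeasureTheory ProbabilityTheory Filter Asymptotics
open scoped Topology

noncomputable section

namespace GlobalNull

/-- Total variation distance `sup_A |P(A) - Q(A)|`, over measurable sets `A`. -/
def tvDist {Ω : Type*} [MeasurableSpace Ω] (P Q : Measure Ω) : ℝ :=
  ⨆ A : {A : Set Ω // MeasurableSet A}, |P.real A - Q.real A|

/-- Law of `X` under the global null `H₀ⁿ`: `n` independent standard normal variables. -/
def nullLaw (n : ℕ) : Measure (Fin n → ℝ) :=
  Measure.pi fun _ => gaussianReal 0 1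

/-- Law of one coordinate under the alternative: `(1 - p) Φ + p (G * Φ)`, i.e. the law of `μ + Z`
with `μ ∼ (1 - p) δ₀ + p G` and an independent standard normal `Z`. -/
def mixtureLaw (p : ℝ) (G : Measure ℝ) : Measure ℝ :=
  ENNReal.ofReal (1 - p) • gaussianReal 0 1 +
    ENNReal.ofReal p • Measure.conv G (gaussianReal 0 1)

/-- Law of `X` under the alternative `H₁ⁿ` with proportion `π_n = n ^ (-β)` of nonzero means and
distribution `G n` of the nonzero means. -/
def altLaw (G : ℕ → Measure ℝ) (β : ℝ) (n : ℕ) : Measure (Fin n → ℝ) :=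
  Measure.pi fun _ => mixtureLaw ((n : ℝ) ^ (-β)) (G n)

/-- Supremum in `[0, 1]` of the sparsity levels at which null and alternative separate perfectly. -/
def lowerCriticalSparsity (G : ℕ → Measure ℝ) : unitInterval :=
  sSup {β : unitInterval |
    Tendsto (fun n : ℕ => tvDist (nullLaw n) (altLaw G (β : ℝ) n)) atTop (𝓝 1)}

/-- Infimum in `[0, 1]` of the sparsity levels at which null and alternative merge
(so it is `1` if there is none). -/
def upperCriticalSparsity (G : ℕ → Measure ℝ) : unitInterval :=
  sInf {β : unitInterval |
    Tendsto (fun n : ℕ => tvDist (nullLaw n) (altLaw G (β : ℝ) n)) atTop (𝓝 0)}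

/-- The sequence `G` has a critical sparsity level, and it is equal to `b`. -/
def IsCriticalSparsity (G : ℕ → Measure ℝ) (b : ℝ) : Prop :=
  (lowerCriticalSparsity G : ℝ) = b ∧ (upperCriticalSparsity G : ℝ) = b

/-- The `1 - α` quantile of `max_i |X_i|` under the global null. -/
def maxThreshold (n : ℕ) (α : ℝ) : ℝ :=
  sInf {t : ℝ | 1 - α ≤ (nullLaw n).real {x | ∀ i, |x i| ≤ t}}

/-- Rejection region of the level-`α` max test: `max_i |X_i|` exceeds its null quantile. -/
def maxTest (α : ℝ) (n : ℕ) : Set (Fin n → ℝ) :=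
  {x | ∃ i, maxThreshold n α < |x i|}

/-- A family of tests, given by the rejection region `R α n` at level `α` and sample size `n`, has
full asymptotic power against the alternatives with sparsity `β`: for each level, the probability
of rejection under `H₁ⁿ` tends to `1`. -/
def HasFullAsymptoticPower (R : (α : ℝ) → (n : ℕ) → Set (Fin n → ℝ)) (G : ℕ → Measure ℝ)
    (β : ℝ) : Prop :=
  ∀ α : ℝ, 0 < α → α < 1 → Tendsto (fun n : ℕ => (altLaw G β n).real (R α n)) atTop (𝓝 1)

/-- The sequence `G` has the critical sparsity level `b`, and the max test has full asymptotic
power at every sparsity level below `b`. -/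
def MaxTestAttainsCriticalSparsity (G : ℕ → Measure ℝ) (b : ℝ) : Prop :=
  IsCriticalSparsity G b ∧ ∀ β : ℝ, 0 ≤ β → β < b → HasFullAsymptoticPower maxTest G β

/-- The scale family `G_n(μ) = G(μ / σ_n)`: the law of `σ_n θ` with `θ ∼ G`. -/
def scaleFamily (G : Measure ℝ) (σ : ℕ → ℝ) (n : ℕ) : Measure ℝ :=
  G.map fun θ => σ n * θ

end GlobalNull

end

/-! Write t = √(2 log n), so that n^c = exp(c t²/2), and any constant or power of t is at most
exp(O(t)) = n^{o(1)}. All three cases reduce to one criterion,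
`maxTestAttainsCriticalSparsity_of_bounds`, whose input is two exponents up to a factor exp(O(t)):
the mass of G_n * Φ beyond ±t should be n^{b-1}, and its likelihood ratio on [-t, t] should be at
most exp(x²/4 + (2b-1)t²/4).

Below b: under the null, n P(|Z| > t) ≤ 2/t → 0, so max |X_i| ≤ t with probability tending to 1.
Under the alternative, the expected number of exceedances is at least n · n^{-β} · n^{b-1} up to
exp(O(t)), which tends to infinity, so some |X_i| exceeds t. The single event {max |X_i| ≤ t}
therefore separates the laws and gives the max test its power (`tendsto_altLaw_forall_abs_le`).

Above b: outside the box [-t, t]^n both laws have vanishing mass. On the box a second moment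
suffices. The factor exp(x²/4), once squared, cancels the Gaussian density
(`integral_truncated_sq_le`), so the excess second moment of the product is governed by n · n^{-2β}
· exp((2b-1)t²/2) = n^{2(b-β)}, up to exp(O(t)), and vanishes (`tendsto_tvDist_zero`).

For each tail of g the exponents come from elementary large deviations. The lower bound on the mass
uses the cheapest split of t into signal σ_n θ and noise. The upper bound uses a matching Chernoff
parameter, or a direct cut for polynomial tails. The likelihood ratio is bounded by completing a
square. The restrictions on ρ and r make b at least 1/2, which keeps (2b-1)t²/4 nonnegative. -/

namespace GlobalNull

/-! ### Total variation and the L² bound. -/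

section TotalVariation

variable {Ω : Type*} [MeasurableSpace Ω] {P Q : Measure Ω}

theorem abs_real_sub_real_le_one [IsProbabilityMeasure P] [IsProbabilityMeasure Q] (A : Set Ω) :
    |P.real A - Q.real A| ≤ 1 := by
  rw [abs_le]
  constructor <;> linarith [measureReal_nonneg (μ := P) (s := A), measureReal_le_one (μ := P) (s := A),
    measureReal_nonneg (μ := Q) (s := A), measureReal_le_one (μ := Q) (s := A)]

theorem tvDist_le {c : ℝ} (h : ∀ A, MeasurableSet A → |P.real A - Q.real A| ≤ c) :
    tvDist P Q ≤ c :=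
  haveI : Nonempty {A : Set Ω // MeasurableSet A} := ⟨⟨∅, MeasurableSet.empty⟩⟩
  ciSup_le fun A => h A.1 A.2

theorem tvDist_nonneg : 0 ≤ tvDist P Q :=
  Real.iSup_nonneg fun _ => abs_nonneg _

theorem tvDist_le_one [IsProbabilityMeasure P] [IsProbabilityMeasure Q] : tvDist P Q ≤ 1 :=
  tvDist_le fun A _ => abs_real_sub_real_le_one A

theorem abs_real_sub_real_le_tvDist [IsProbabilityMeasure P] [IsProbabilityMeasure Q] {A : Set Ω}
    (hA : MeasurableSet A) : |P.real A - Q.real A| ≤ tvDist P Q := by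
  refine le_ciSup (f := fun A : {A : Set Ω // MeasurableSet A} => |P.real A - Q.real A|)
    ⟨1, ?_⟩ ⟨A, hA⟩
  rintro _ ⟨B, rfl⟩
  exact abs_real_sub_real_le_one _

/-- A truncated second moment bound: the set integrals of `F` differ from the measure of the set by
at most the `L²` distance from `F` to the constant `1`. -/
theorem abs_real_sub_setIntegral_le [IsProbabilityMeasure P] {F : Ω → ℝ} (hF : MemLp F 2 P)
    (A : Set Ω) :
    |P.real A - ∫ x in A, F x ∂P| ≤ √(∫ x, F x ^ 2 ∂P - 2 * ∫ x, F x ∂P + 1) := by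
  have hFi : Integrable F P := hF.integrable one_le_two
  have hG : MemLp (fun x => |1 - F x|) 2 P := ((memLp_const (1 : ℝ)).sub hF).norm
  have hGi : Integrable (fun x => |1 - F x|) P := hG.integrable one_le_two
  have hone : P.real A - ∫ x in A, F x ∂P = ∫ x in A, (1 - F x) ∂P := by
    rw [integral_sub (integrable_const _).integrableOn hFi.integrableOn]
    simp
  -- Nonnegativity of the variance of |1 - F| serves as the Cauchy–Schwarz inequality (E|1 - F|)² ≤
  -- E|1 - F|².
  have hvar := variance_nonneg (fun x => |1 - F x|) P
  rw [variance_eq_sub hG] at hvar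
  have hsq : ∫ x, |1 - F x| ^ 2 ∂P = ∫ x, F x ^ 2 ∂P - 2 * ∫ x, F x ∂P + 1 := by
    have : ∀ x, |1 - F x| ^ 2 = F x ^ 2 - 2 * F x + 1 := fun x => by rw [sq_abs]; ring
    simp_rw [this]
    have hdiff := hF.integrable_sq.sub (hFi.const_mul 2)
    rw [integral_add (f := fun x => F x ^ 2 - 2 * F x) hdiff (integrable_const _),
      integral_sub hF.integrable_sq (hFi.const_mul 2), integral_const_mul]
    simp
  rw [hone]
  calc |∫ x in A, (1 - F x) ∂P| ≤ ∫ x in A, |1 - F x| ∂P := abs_integral_le_integral_abs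
    _ ≤ ∫ x, |1 - F x| ∂P := setIntegral_le_integral hGi (ae_of_all _ fun _ => abs_nonneg _)
    _ ≤ _ := by
      apply Real.le_sqrt_of_sq_le
      rw [← hsq]
      simpa using hvar

end TotalVariation

/-! ### Product measures truncated to a box. -/

section Product

variable {α : Type*} [MeasurableSpace α] {P Q : Measure α} {B : Set α} {f : α → ℝ} {n : ℕ}

/-- A product measure is determined by its values on boxes, where Fubini factors the integral of the
product density. -/
theorem restrict_pi_eq_withDensity_prod [IsProbabilityMeasure P] [IsProbabilityMeasure Q]
    (hf0 : ∀ x, 0 ≤ f x) (hfi : Integrable f P)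
    (hQ : Q.restrict B = P.withDensity fun x => ENNReal.ofReal (f x)) :
    (Measure.pi fun _ : Fin n => Q).restrict (Set.univ.pi fun _ => B) =
      (Measure.pi fun _ : Fin n => P).withDensity fun x => ENNReal.ofReal (∏ i, f (x i)) := by
  rw [Measure.restrict_pi_pi]
  refine Measure.pi_eq fun s hs => ?_
  have hint : Integrable (fun x : Fin n → α => ∏ i, f (x i)) (Measure.pi fun _ => P) :=
    Integrable.fintype_prod fun _ => hfi
  rw [withDensity_apply _ (MeasurableSet.univ_pi hs), ← ofReal_integral_eq_lintegral_ofReal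
    hint.integrableOn (ae_of_all _ fun x => Finset.prod_nonneg fun i _ => hf0 _),
    Measure.restrict_pi_pi, integral_fintype_prod_eq_prod (fun _ => f),
    ENNReal.ofReal_prod_of_nonneg fun i _ => integral_nonneg hf0]
  refine Finset.prod_congr rfl fun i _ => ?_
  rw [hQ, withDensity_apply _ (hs i), ofReal_integral_eq_lintegral_ofReal hfi.integrableOn
    (ae_of_all _ hf0)]

/-- Total variation between product measures, by truncation to a box and a second moment bound for
the truncated likelihood ratio. -/
theorem tvDist_pi_le [IsProbabilityMeasure P] [IsProbabilityMeasure Q] (hB : MeasurableSet B)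
    (hf0 : ∀ x, 0 ≤ f x) (hf : MemLp f 2 P)
    (hQ : Q.restrict B = P.withDensity fun x => ENNReal.ofReal (f x)) :
    tvDist (Measure.pi fun _ : Fin n => P) (Measure.pi fun _ : Fin n => Q) ≤
      (1 - Q.real B ^ n) + √((∫ x, f x ^ 2 ∂P) ^ n - 2 * Q.real B ^ n + 1) := by
  refine tvDist_le fun A hA => ?_
  have hfi : Integrable f P := hf.integrable one_le_two
  set F : (Fin n → α) → ℝ := fun x => ∏ i, f (x i) with hFdef
  have hF0 : ∀ x, 0 ≤ F x := fun x => Finset.prod_nonneg fun i _ => hf0 _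
  have hFi : Integrable F (Measure.pi fun _ => P) := Integrable.fintype_prod fun _ => hfi
  have hF2 : Integrable (fun x => F x ^ 2) (Measure.pi fun _ => P) := by
    simp_rw [hFdef, ← Finset.prod_pow]
    exact Integrable.fintype_prod (f := fun _ x => f x ^ 2) fun _ => hf.integrable_sq
  have hFL : MemLp F 2 (Measure.pi fun _ => P) :=
    (memLp_two_iff_integrable_sq hFi.aestronglyMeasurable).2 hF2
  have hbox : MeasurableSet (Set.univ.pi fun _ : Fin n => B) := MeasurableSet.univ_pi fun _ => hB
  have hrestr := restrict_pi_eq_withDensity_prod (n := n) hf0 hfi hQ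
  have hAbox : (Measure.pi fun _ : Fin n => Q).real (A ∩ Set.univ.pi fun _ => B) =
      ∫ x in A, F x ∂(Measure.pi fun _ => P) := by
    rw [measureReal_def, ← Measure.restrict_apply hA, hrestr, withDensity_apply _ hA,
      ← ofReal_integral_eq_lintegral_ofReal hFi.integrableOn (ae_of_all _ hF0),
      ENNReal.toReal_ofReal (integral_nonneg hF0)]
  have hintf : ∫ x, f x ∂P = Q.real B := by
    rw [measureReal_def, ← Measure.restrict_apply_univ, hQ, withDensity_apply _ MeasurableSet.univ,
      Measure.restrict_univ, ← ofReal_integral_eq_lintegral_ofReal hfi (ae_of_all _ hf0),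
      ENNReal.toReal_ofReal (integral_nonneg hf0)]
  have hintF : ∫ x, F x ∂(Measure.pi fun _ => P) = Q.real B ^ n := by
    rw [integral_fintype_prod_eq_pow, hintf, Fintype.card_fin]
  have hintF2 : ∫ x, F x ^ 2 ∂(Measure.pi fun _ => P) = (∫ x, f x ^ 2 ∂P) ^ n := by
    simp_rw [hFdef, ← Finset.prod_pow]
    rw [integral_fintype_prod_eq_pow (fun x => f x ^ 2), Fintype.card_fin]
  have hmain := abs_real_sub_setIntegral_le hFL A
  rw [hintF, hintF2, ← hAbox] at hmain
  have hsplit := measureReal_inter_add_sdiff (μ := Measure.pi fun _ : Fin n => Q) (s := A) hbox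
  have hQbox : (Measure.pi fun _ : Fin n => Q).real (Set.univ.pi fun _ => B) = Q.real B ^ n := by
    simp [measureReal_def, Measure.pi_pi]
  -- The part of `A` outside the box has no density control; it costs at most the mass `Q` puts
  -- there.
  have hdiff : (Measure.pi fun _ : Fin n => Q).real (A \ Set.univ.pi fun _ => B) ≤
      1 - Q.real B ^ n := by
    rw [← hQbox, ← probReal_compl_eq_one_sub hbox]
    exact measureReal_mono fun x hx => hx.2
  have hdiff0 : 0 ≤ (Measure.pi fun _ : Fin n => Q).real (A \ Set.univ.pi fun _ => B) :=
    measureReal_nonneg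
  rw [abs_le] at hmain ⊢
  constructor <;> linarith [hmain.1, hmain.2]

end Product

/-! ### Gaussian tail estimates and change of mean. -/

section Gaussian

/-- Chernoff's bound applied to both tails. The parameter `l` stays free because each tail class of
g needs its own choice. -/
theorem gaussianReal_abs_gt_le (m t : ℝ) {l : ℝ} (hl : 0 ≤ l) :
    (gaussianReal m 1).real {x | t < |x|} ≤ 2 * Real.exp (-l * t + l ^ 2 / 2 + l * |m|) := by
  have h1 := measure_ge_le_exp_mul_mgf (μ := gaussianReal m 1) (X := id) t hl
    (integrable_exp_mul_gaussianReal l)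
  have h2 := measure_le_le_exp_mul_mgf (μ := gaussianReal m 1) (X := id) (-t)
    (neg_nonpos.2 hl) (integrable_exp_mul_gaussianReal (-l))
  rw [mgf_id_gaussianReal, ← Real.exp_add] at h1 h2
  have hsub : {x : ℝ | t < |x|} ⊆ {x | t ≤ id x} ∪ {x | id x ≤ -t} := by
    intro x hx
    rcases lt_abs.1 (show t < |x| from hx) with h | h
    · exact Or.inl h.le
    · exact Or.inr (by simp only [Set.mem_ofPred_eq, id]; linarith)
  have h3 := (measureReal_mono hsub).trans (measureReal_union_le (μ := gaussianReal m 1) _ _)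
  have e1 : Real.exp (-l * t + (m * l + ((1 : NNReal) : ℝ) * l ^ 2 / 2)) ≤
      Real.exp (-l * t + l ^ 2 / 2 + l * |m|) := by
    apply Real.exp_le_exp.2
    push_cast
    nlinarith [mul_le_mul_of_nonneg_left (le_abs_self m) hl]
  have e2 : Real.exp (- -l * -t + (m * -l + ((1 : NNReal) : ℝ) * (-l) ^ 2 / 2)) ≤
      Real.exp (-l * t + l ^ 2 / 2 + l * |m|) := by
    apply Real.exp_le_exp.2
    push_cast
    nlinarith [mul_le_mul_of_nonneg_left (neg_abs_le m) hl]
  linarith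

theorem gaussianPDFReal_zero_one (x : ℝ) :
    gaussianPDFReal 0 1 x = (√(2 * Real.pi))⁻¹ * Real.exp (-x ^ 2 / 2) := by
  simp [gaussianPDFReal]

theorem inv_sqrt_two_pi_le_one : (√(2 * Real.pi))⁻¹ ≤ 1 :=
  inv_le_one_of_one_le₀ (Real.one_le_sqrt.2 (by linarith [Real.pi_gt_three]))

/-- The tangent line at t gives -x²/2 ≤ t²/2 - tx. The gain of 1/t over Chernoff is essential: at t
= √(2 log n) it is what makes n times the tail vanish rather than merely stay bounded. -/
theorem gaussianReal_Ioi_le {t : ℝ} (ht : 0 < t) :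
    (gaussianReal 0 1).real (Set.Ioi t) ≤ Real.exp (-t ^ 2 / 2) / t := by
  rw [measureReal_def, gaussianReal_apply_eq_integral _ one_ne_zero,
    ENNReal.toReal_ofReal (integral_nonneg fun _ => gaussianPDFReal_nonneg _ _ _)]
  have hint : IntegrableOn (fun x => Real.exp (t ^ 2 / 2) * Real.exp (-t * x)) (Set.Ioi t) :=
    (integrableOn_exp_mul_Ioi (neg_lt_zero.2 ht) t).const_mul _
  calc ∫ x in Set.Ioi t, gaussianPDFReal 0 1 x
      ≤ ∫ x in Set.Ioi t, Real.exp (t ^ 2 / 2) * Real.exp (-t * x) := by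
        refine integral_mono (integrable_gaussianPDFReal 0 1).integrableOn hint fun x => ?_
        simp only [gaussianPDFReal_zero_one, ← Real.exp_add]
        refine (mul_le_of_le_one_left (Real.exp_pos _).le inv_sqrt_two_pi_le_one).trans ?_
        apply Real.exp_le_exp.2
        nlinarith [sq_nonneg (x - t)]
    _ = Real.exp (-t ^ 2 / 2) / t := by
        rw [integral_const_mul, integral_exp_mul_Ioi (neg_lt_zero.2 ht), neg_div_neg_eq,
          mul_div_assoc', ← Real.exp_add]
        congr 2
        ring

theorem gaussianReal_standard_abs_gt_le {t : ℝ} (ht : 0 < t) :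
    (gaussianReal 0 1).real {x | t < |x|} ≤ 2 * (Real.exp (-t ^ 2 / 2) / t) := by
  have hsub : {x : ℝ | t < |x|} ⊆ Set.Ioi t ∪ (fun x => -x) ⁻¹' Set.Ioi t := by
    intro x hx
    exact lt_abs.1 (show t < |x| from hx)
  have hneg : (gaussianReal 0 1).real ((fun x => -x) ⁻¹' Set.Ioi t) =
      (gaussianReal 0 1).real (Set.Ioi t) := by
    rw [← map_measureReal_apply measurable_neg measurableSet_Ioi, gaussianReal_map_neg, neg_zero]
  have h3 := (measureReal_mono hsub).trans (measureReal_union_le (μ := gaussianReal 0 1) _ _)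
  rw [hneg] at h3
  linarith [gaussianReal_Ioi_le ht]

/-- On (s, s+1] the density is at least its value at s+1. The loss relative to exp(-s²/2) is exp(-s
- 1/2) and a constant, harmless up to exp(O(t)) when s = O(t). -/
theorem le_gaussianReal_Ioi {s : ℝ} (hs : 0 ≤ s) :
    (√(2 * Real.pi))⁻¹ * Real.exp (-(s + 1) ^ 2 / 2) ≤ (gaussianReal 0 1).real (Set.Ioi s) := by
  refine le_trans ?_ (measureReal_mono (s₁ := Set.Ioc s (s + 1)) fun x hx => hx.1)
  rw [measureReal_def, gaussianReal_apply_eq_integral _ one_ne_zero,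
    ENNReal.toReal_ofReal (integral_nonneg fun _ => gaussianPDFReal_nonneg _ _ _)]
  calc (√(2 * Real.pi))⁻¹ * Real.exp (-(s + 1) ^ 2 / 2)
      = ∫ x in Set.Ioc s (s + 1), (√(2 * Real.pi))⁻¹ * Real.exp (-(s + 1) ^ 2 / 2) := by simp
    _ ≤ _ := by
      refine setIntegral_mono_on (integrableOn_const (by simp)) (integrable_gaussianPDFReal 0 1).integrableOn
        measurableSet_Ioc fun x hx => ?_
      rw [gaussianPDFReal_zero_one]
      gcongr
      · linarith [hx.1]
      · exact hx.2

theorem gaussianReal_eq_withDensity_standard (m : ℝ) :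
    gaussianReal m 1 = (gaussianReal 0 1).withDensity
      fun x => ENNReal.ofReal (Real.exp (m * x - m ^ 2 / 2)) := by
  rw [gaussianReal_of_var_ne_zero _ one_ne_zero, gaussianReal_of_var_ne_zero _ one_ne_zero,
    ← withDensity_mul _ (measurable_gaussianPDF 0 1) (by fun_prop)]
  congr 1
  ext x
  simp only [Pi.mul_apply, gaussianPDF, gaussianPDFReal]
  rw [← ENNReal.ofReal_mul (by positivity), mul_assoc (√_)⁻¹, ← Real.exp_add]
  congr 3
  push_cast
  ring

end Gaussian

/-! ### Convolution with the standard normal law and its likelihood ratio. -/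

section Convolution

theorem conv_gaussian_apply (H : Measure ℝ) {A : Set ℝ} (hA : MeasurableSet A) :
    Measure.conv H (gaussianReal 0 1) A = ∫⁻ m, gaussianReal m 1 A ∂H := by
  rw [Measure.conv, Measure.map_apply (by fun_prop) hA,
    Measure.prod_apply (measurable_add hA)]
  refine lintegral_congr fun m => ?_
  have := gaussianReal_map_const_add (μ := 0) (v := 1) m
  rw [zero_add] at this
  rw [← this, Measure.map_apply (by fun_prop) hA]
  rfl

/-- The likelihood ratio of `H * N(0, 1)` with respect to `N(0, 1)`. -/
noncomputable def likelihoodRatio (H : Measure ℝ) (x : ℝ) : ENNReal :=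
  ∫⁻ m, ENNReal.ofReal (Real.exp (m * x - m ^ 2 / 2)) ∂H

variable (H : Measure ℝ) [IsProbabilityMeasure H]

theorem measurable_likelihoodRatio : Measurable (likelihoodRatio H) :=
  Measurable.lintegral_prod_right' (f := fun z : ℝ × ℝ =>
    ENNReal.ofReal (Real.exp (z.2 * z.1 - z.2 ^ 2 / 2))) (by fun_prop)

theorem conv_gaussian_eq_withDensity :
    Measure.conv H (gaussianReal 0 1) = (gaussianReal 0 1).withDensity (likelihoodRatio H) := by
  ext A hA
  rw [conv_gaussian_apply H hA, withDensity_apply _ hA]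
  unfold likelihoodRatio
  rw [lintegral_lintegral_swap (by fun_prop)]
  refine lintegral_congr fun m => ?_
  rw [gaussianReal_eq_withDensity_standard, withDensity_apply _ hA]

/-- A signal above a and an independent noise above s together exceed t. The freedom to split t is
used to find the cheapest way of crossing the threshold. -/
theorem mul_le_conv_gaussian_abs_gt {a s t : ℝ} (h : t ≤ a + s) :
    H.real (Set.Ioi a) * (gaussianReal 0 1).real (Set.Ioi s) ≤
      (Measure.conv H (gaussianReal 0 1)).real {x | t < |x|} := by
  have hA : MeasurableSet {x : ℝ | t < |x|} := measurableSet_lt measurable_const measurable_abs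
  rw [← measureReal_prod_prod, Measure.conv, map_measureReal_apply (by fun_prop) hA]
  refine measureReal_mono fun z hz => ?_
  have h1 : a < z.1 := hz.1
  have h2 : s < z.2 := hz.2
  exact lt_of_lt_of_le (show t < z.1 + z.2 by linarith) (le_abs_self _)

end Convolution

/-! ### The sparse mixture in one coordinate. -/

section Mixture

variable (H : Measure ℝ) [IsProbabilityMeasure H] {p : ℝ}

theorem mixtureLaw_real_apply (h0 : 0 ≤ p) (h1 : p ≤ 1) (A : Set ℝ) :
    (mixtureLaw p H).real A = (1 - p) * (gaussianReal 0 1).real A +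
      p * (Measure.conv H (gaussianReal 0 1)).real A := by
  rw [mixtureLaw, measureReal_add_apply
    (ENNReal.mul_ne_top ENNReal.ofReal_ne_top (measure_ne_top _ _))
    (ENNReal.mul_ne_top ENNReal.ofReal_ne_top (measure_ne_top _ _)), measureReal_ennreal_smul_apply,
    measureReal_ennreal_smul_apply, ENNReal.toReal_ofReal h0, ENNReal.toReal_ofReal (by linarith)]

theorem isProbabilityMeasure_mixtureLaw (h0 : 0 ≤ p) (h1 : p ≤ 1) :
    IsProbabilityMeasure (mixtureLaw p H) := by
  constructor
  rw [mixtureLaw, Measure.add_apply, Measure.smul_apply, Measure.smul_apply, measure_univ,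
    measure_univ, smul_eq_mul, smul_eq_mul, mul_one, mul_one,
    ← ENNReal.ofReal_add (by linarith) h0]
  simp

end Mixture

/-! ### The threshold √(2 log n) and powers of n written through it. -/

section Threshold

/-- The detection threshold `√(2 log n)`. -/
noncomputable def sqrtTwoLog (n : ℕ) : ℝ := √(2 * Real.log n)

theorem sqrtTwoLog_sq (n : ℕ) : sqrtTwoLog n ^ 2 = 2 * Real.log n :=
  Real.sq_sqrt (by have := Real.log_natCast_nonneg n; positivity)

theorem tendsto_sqrtTwoLog : Tendsto sqrtTwoLog atTop atTop :=
  Real.tendsto_sqrt_atTop.comp ((Real.tendsto_log_atTop.comp tendsto_natCast_atTop_atTop).const_mul_atTop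
    two_pos)

theorem natCast_rpow_eq_exp {n : ℕ} (hn : 1 ≤ n) (c : ℝ) :
    (n : ℝ) ^ c = Real.exp (c * sqrtTwoLog n ^ 2 / 2) := by
  rw [sqrtTwoLog_sq, Real.rpow_def_of_pos (by exact_mod_cast hn)]
  congr 1
  ring

theorem natCast_eq_exp {n : ℕ} (hn : 1 ≤ n) : (n : ℝ) = Real.exp (sqrtTwoLog n ^ 2 / 2) := by
  have := natCast_rpow_eq_exp hn 1
  rwa [Real.rpow_one, one_mul] at this

theorem tendsto_quadratic_atTop {c : ℝ} (hc : 0 < c) (K : ℝ) :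
    Tendsto (fun t : ℝ => c * t ^ 2 - K * t) atTop atTop := by
  have h : Tendsto (fun t : ℝ => t * (c * t + -K)) atTop atTop :=
    tendsto_id.atTop_mul_atTop₀ (tendsto_atTop_add_const_right _ _ (tendsto_id.const_mul_atTop hc))
  refine h.congr fun t => ?_
  ring

theorem tendsto_exp_quadratic_zero {c : ℝ} (hc : c < 0) (K : ℝ) :
    Tendsto (fun t : ℝ => Real.exp (c * t ^ 2 + K * t)) atTop (𝓝 0) := by
  have h := Real.tendsto_exp_neg_atTop_nhds_zero.comp (tendsto_quadratic_atTop (neg_pos.2 hc) K)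
  refine h.congr fun t => ?_
  simp only [Function.comp]
  congr 1
  ring

theorem setOf_forall_abs_le (n : ℕ) (s : ℝ) :
    {x : Fin n → ℝ | ∀ i, |x i| ≤ s} = Set.univ.pi fun _ => {y : ℝ | s < |y|}ᶜ := by
  ext x
  simp

end Threshold

/-! ### Below the critical level: the maximum separates the hypotheses. -/

section Separation

theorem measurableSet_abs_gt (s : ℝ) : MeasurableSet {y : ℝ | s < |y|} :=
  measurableSet_lt measurable_const measurable_abs

theorem pi_real_forall_abs_le (Q : Measure ℝ) [IsProbabilityMeasure Q] (n : ℕ) (s : ℝ) :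
    (Measure.pi fun _ : Fin n => Q).real {x | ∀ i, |x i| ≤ s} = (1 - Q.real {y | s < |y|}) ^ n := by
  rw [setOf_forall_abs_le, measureReal_def, Measure.pi_pi, ENNReal.toReal_prod,
    ← probReal_compl_eq_one_sub (measurableSet_abs_gt s)]
  simp [measureReal_def]

theorem one_sub_mul_le_one_sub_pow {x : ℝ} (hx : x ≤ 1) (n : ℕ) : 1 - n * x ≤ (1 - x) ^ n := by
  have := one_add_mul_le_pow (a := -x) (by linarith) n
  rw [← sub_eq_add_neg] at this
  linarith

instance (n : ℕ) : IsProbabilityMeasure (nullLaw n) := by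
  unfold nullLaw; infer_instance

theorem natCast_mul_gaussianReal_abs_gt_le {n : ℕ} (hn : 1 ≤ n) (ht : 0 < sqrtTwoLog n) :
    n * (gaussianReal 0 1).real {y | sqrtTwoLog n < |y|} ≤ 2 / sqrtTwoLog n := by
  calc n * (gaussianReal 0 1).real {y | sqrtTwoLog n < |y|}
      ≤ n * (2 * (Real.exp (-sqrtTwoLog n ^ 2 / 2) / sqrtTwoLog n)) := by
        gcongr
        exact gaussianReal_standard_abs_gt_le ht
    _ = 2 / sqrtTwoLog n := by
        have : (n : ℝ) * Real.exp (-sqrtTwoLog n ^ 2 / 2) = 1 := by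
          rw [natCast_eq_exp hn, ← Real.exp_add, ← Real.exp_zero]
          congr 1
          ring
        linear_combination (2 / sqrtTwoLog n) * this

theorem tendsto_nullLaw_forall_abs_le :
    Tendsto (fun n : ℕ => (nullLaw n).real {x | ∀ i, |x i| ≤ sqrtTwoLog n}) atTop (𝓝 1) := by
  have hlim : Tendsto (fun n : ℕ => 1 - 2 / sqrtTwoLog n) atTop (𝓝 1) := by
    simpa using (tendsto_sqrtTwoLog.const_div_atTop 2).const_sub 1
  refine tendsto_of_tendsto_of_tendsto_of_le_of_le' hlim tendsto_const_nhds ?_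
    (Eventually.of_forall fun n => measureReal_le_one)
  filter_upwards [eventually_ge_atTop 1, tendsto_sqrtTwoLog.eventually_gt_atTop 0] with n hn ht
  rw [nullLaw, pi_real_forall_abs_le]
  refine le_trans ?_ (one_sub_mul_le_one_sub_pow measureReal_le_one n)
  linarith [natCast_mul_gaussianReal_abs_gt_le hn ht]

/-- The null probability of {max |x_i| ≤ t} tends to 1, hence exceeds 1 - α eventually, so t belongs
to the set whose infimum is the quantile. -/
theorem eventually_maxThreshold_le {α : ℝ} (h0 : 0 < α) (h1 : α < 1) :
    ∀ᶠ n : ℕ in atTop, maxThreshold n α ≤ sqrtTwoLog n := by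
  filter_upwards [tendsto_nullLaw_forall_abs_le.eventually_const_le (show 1 - α < 1 by linarith),
    eventually_ge_atTop 1] with n hn hn1
  -- The infimum is meaningful only if the set is bounded below. Having at least one coordinate
  -- ensures this: a negative level gives the empty event, of probability 0 < 1 - α.
  refine csInf_le ⟨0, fun s hs => ?_⟩ hn
  by_contra hneg
  have hempty : {x : Fin n → ℝ | ∀ i, |x i| ≤ s} = ∅ := by
    ext x
    simp only [Set.mem_ofPred_eq, Set.mem_empty_iff_false, iff_false]
    intro h
    linarith [h ⟨0, hn1⟩, abs_nonneg (x ⟨0, hn1⟩)]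
  have hs' : 1 - α ≤ (nullLaw n).real {x | ∀ i, |x i| ≤ s} := hs
  rw [hempty, measureReal_empty] at hs'
  linarith

variable {G : ℕ → Measure ℝ} [∀ n, IsProbabilityMeasure (G n)] {b β K : ℝ}

theorem natCast_rpow_neg_le_one {n : ℕ} (hn : 1 ≤ n) (hβ : 0 ≤ β) : (n : ℝ) ^ (-β) ≤ 1 :=
  Real.rpow_le_one_of_one_le_of_nonpos (by exact_mod_cast hn) (neg_nonpos.2 hβ)

theorem isProbabilityMeasure_altLaw {n : ℕ} (hn : 1 ≤ n) (hβ : 0 ≤ β) :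
    IsProbabilityMeasure (altLaw G β n) := by
  have := isProbabilityMeasure_mixtureLaw (G n) (p := (n : ℝ) ^ (-β)) (by positivity)
    (natCast_rpow_neg_le_one hn hβ)
  unfold altLaw
  infer_instance

/-- With q the exceedance probability of one coordinate, (1 - q)^n ≤ exp(-nq), and nq is at least
exp((b - β)t²/2 - Kt), which diverges since β < b. -/
theorem tendsto_altLaw_forall_abs_le (hβ0 : 0 ≤ β) (hβ : β < b)
    (hlow : ∀ᶠ n : ℕ in atTop, Real.exp ((b - 1) * sqrtTwoLog n ^ 2 / 2 - K * sqrtTwoLog n) ≤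
      (Measure.conv (G n) (gaussianReal 0 1)).real {y | sqrtTwoLog n < |y|}) :
    Tendsto (fun n : ℕ => (altLaw G β n).real {x | ∀ i, |x i| ≤ sqrtTwoLog n}) atTop (𝓝 0) := by
  have hlim : Tendsto (fun n : ℕ => Real.exp (-Real.exp ((b - β) / 2 * sqrtTwoLog n ^ 2 -
      K * sqrtTwoLog n))) atTop (𝓝 0) :=
    Real.tendsto_exp_neg_atTop_nhds_zero.comp (Real.tendsto_exp_atTop.comp
      ((tendsto_quadratic_atTop (by linarith : 0 < (b - β) / 2) K).comp tendsto_sqrtTwoLog))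
  refine tendsto_of_tendsto_of_tendsto_of_le_of_le' tendsto_const_nhds hlim
    (Eventually.of_forall fun n => measureReal_nonneg) ?_
  filter_upwards [eventually_ge_atTop 1, hlow] with n hn hlow
  set p : ℝ := (n : ℝ) ^ (-β) with hp
  have hp0 : 0 ≤ p := by positivity
  have hp1 : p ≤ 1 := natCast_rpow_neg_le_one hn hβ0
  have := isProbabilityMeasure_mixtureLaw (G n) hp0 hp1
  set q : ℝ := (mixtureLaw p (G n)).real {y | sqrtTwoLog n < |y|} with hq
  have hq1 : q ≤ 1 := measureReal_le_one
  rw [altLaw, pi_real_forall_abs_le, ← hp, ← hq]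
  have hqlow : Real.exp ((b - β) / 2 * sqrtTwoLog n ^ 2 - K * sqrtTwoLog n) ≤ n * q := by
    calc Real.exp ((b - β) / 2 * sqrtTwoLog n ^ 2 - K * sqrtTwoLog n)
        = n * (p * Real.exp ((b - 1) * sqrtTwoLog n ^ 2 / 2 - K * sqrtTwoLog n)) := by
          rw [hp, natCast_rpow_eq_exp hn, natCast_eq_exp hn, ← Real.exp_add, ← Real.exp_add]
          congr 1
          ring
      _ ≤ n * q := by
          rw [hq, mixtureLaw_real_apply (G n) hp0 hp1]
          have h1 : 0 ≤ (1 - p) * (gaussianReal 0 1).real {y | sqrtTwoLog n < |y|} :=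
            mul_nonneg (by linarith) measureReal_nonneg
          have h2 := mul_le_mul_of_nonneg_left hlow hp0
          gcongr
          linarith
  calc (1 - q) ^ n ≤ Real.exp (-q) ^ n :=
        pow_le_pow_left₀ (by linarith) (Real.one_sub_le_exp_neg q) n
    _ = Real.exp (-(n * q)) := by rw [← Real.exp_nat_mul]; congr 1; ring
    _ ≤ _ := Real.exp_le_exp.2 (neg_le_neg hqlow)

theorem measurableSet_forall_abs_le (n : ℕ) (s : ℝ) :
    MeasurableSet {x : Fin n → ℝ | ∀ i, |x i| ≤ s} := by
  rw [setOf_forall_abs_le]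
  exact MeasurableSet.univ_pi fun _ => (measurableSet_abs_gt s).compl

theorem hasFullAsymptoticPower_maxTest (hβ0 : 0 ≤ β)
    (h : Tendsto (fun n : ℕ => (altLaw G β n).real {x | ∀ i, |x i| ≤ sqrtTwoLog n}) atTop (𝓝 0)) :
    HasFullAsymptoticPower maxTest G β := by
  intro α h0 h1
  have hlim := h.const_sub 1
  rw [sub_zero] at hlim
  refine tendsto_of_tendsto_of_tendsto_of_le_of_le' hlim tendsto_const_nhds ?_ ?_
  · filter_upwards [eventually_ge_atTop 1, eventually_maxThreshold_le h0 h1] with n hn hle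
    have := isProbabilityMeasure_altLaw (G := G) hn hβ0
    rw [← probReal_compl_eq_one_sub (measurableSet_forall_abs_le n _)]
    refine measureReal_mono fun x hx => ?_
    simp only [Set.mem_compl_iff, Set.mem_ofPred_eq, not_forall, not_le] at hx
    obtain ⟨i, hi⟩ := hx
    exact ⟨i, hle.trans_lt hi⟩
  · filter_upwards [eventually_ge_atTop 1] with n hn
    have := isProbabilityMeasure_altLaw (G := G) hn hβ0
    exact measureReal_le_one

theorem tendsto_tvDist_one (hβ0 : 0 ≤ β)
    (h : Tendsto (fun n : ℕ => (altLaw G β n).real {x | ∀ i, |x i| ≤ sqrtTwoLog n}) atTop (𝓝 0)) :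
    Tendsto (fun n : ℕ => tvDist (nullLaw n) (altLaw G β n)) atTop (𝓝 1) := by
  have hlim := tendsto_nullLaw_forall_abs_le.sub h
  rw [sub_zero] at hlim
  refine tendsto_of_tendsto_of_tendsto_of_le_of_le' hlim tendsto_const_nhds ?_ ?_
  · filter_upwards [eventually_ge_atTop 1] with n hn
    have := isProbabilityMeasure_altLaw (G := G) hn hβ0
    exact (le_abs_self _).trans (abs_real_sub_real_le_tvDist (measurableSet_forall_abs_le n _))
  · filter_upwards [eventually_ge_atTop 1] with n hn
    have := isProbabilityMeasure_altLaw (G := G) hn hβ0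
    exact tvDist_le_one

end Separation

/-! ### Above the critical level: the truncated second moment, and the general criterion. -/

section Merging

/-- The square of exp(x²/4) cancels exp(-x²/2) in the normal density, so the integrand is at most E²
on an interval of length 2t. -/
theorem integral_truncated_sq_le (H : Measure ℝ) {t E : ℝ} (ht : 0 ≤ t) (hE : 0 ≤ E)
    (hbd : ∀ x, |x| ≤ t →
      likelihoodRatio H x ≤ ENNReal.ofReal (E * Real.exp (x ^ 2 / 4))) :
    ∫ x, {y : ℝ | t < |y|}ᶜ.indicator (fun x => (likelihoodRatio H x).toReal) x ^ 2
      ∂(gaussianReal 0 1) ≤ 2 * t * E ^ 2 := by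
  have hset : {y : ℝ | t < |y|}ᶜ = Set.Icc (-t) t := by
    ext y; simp [abs_le]
  rw [integral_gaussianReal_eq_integral_smul one_ne_zero, hset]
  have hint : Integrable (fun x => (Set.Icc (-t) t).indicator (fun _ => E ^ 2) x) :=
    (integrable_indicator_iff measurableSet_Icc).2 (integrableOn_const (by simp))
  calc _ ≤ ∫ x, (Set.Icc (-t) t).indicator (fun _ => E ^ 2) x := by
        refine integral_mono_of_nonneg (ae_of_all _ fun x => ?_) hint (ae_of_all _ fun x => ?_)
        · exact smul_nonneg (gaussianPDFReal_nonneg _ _ _) (sq_nonneg _)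
        · by_cases hx : x ∈ Set.Icc (-t) t
          · simp only [Set.indicator_of_mem hx, smul_eq_mul, gaussianPDFReal_zero_one]
            have h1 : (likelihoodRatio H x).toReal ≤ E * Real.exp (x ^ 2 / 4) :=
              ENNReal.toReal_le_of_le_ofReal (by positivity) (hbd x (abs_le.2 hx))
            have h2 : (likelihoodRatio H x).toReal ^ 2 ≤ E ^ 2 * Real.exp (x ^ 2 / 2) := by
              calc _ ≤ (E * Real.exp (x ^ 2 / 4)) ^ 2 := by gcongr
                _ = _ := by
                  rw [mul_pow, ← Real.exp_nat_mul]
                  congr 2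
                  push_cast
                  ring
            calc (√(2 * Real.pi))⁻¹ * Real.exp (-x ^ 2 / 2) * (likelihoodRatio H x).toReal ^ 2
                ≤ 1 * Real.exp (-x ^ 2 / 2) * (E ^ 2 * Real.exp (x ^ 2 / 2)) := by
                  gcongr
                  exact inv_sqrt_two_pi_le_one
              _ = E ^ 2 * (Real.exp (-x ^ 2 / 2) * Real.exp (x ^ 2 / 2)) := by ring
              _ = E ^ 2 := by
                rw [← Real.exp_add, show -x ^ 2 / 2 + x ^ 2 / 2 = 0 by ring, Real.exp_zero, mul_one]
          · simp [Set.indicator_of_notMem hx]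
    _ = 2 * t * E ^ 2 := by
        rw [integral_indicator measurableSet_Icc]
        simp only [integral_const, MeasurableSet.univ, measureReal_restrict_apply, Set.univ_inter,
          Real.volume_real_Icc, smul_eq_mul]
        rw [max_eq_left (by linarith)]
        ring

/-- Total variation between null and alternative, by truncation of the likelihood ratio. -/
theorem tvDist_pi_mixtureLaw_le (H : Measure ℝ) [IsProbabilityMeasure H] {p t E δ : ℝ} (n : ℕ)
    (hp0 : 0 ≤ p) (hp1 : p ≤ 1) (ht : 0 ≤ t) (hE : 0 ≤ E)
    (hbd : ∀ x, |x| ≤ t → likelihoodRatio H x ≤ ENNReal.ofReal (E * Real.exp (x ^ 2 / 4)))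
    (hδ : n * (mixtureLaw p H).real {y | t < |y|} ≤ δ) :
    tvDist (Measure.pi fun _ : Fin n => gaussianReal 0 1)
      (Measure.pi fun _ : Fin n => mixtureLaw p H) ≤
      δ + √(Real.exp (n * (p ^ 2 * (2 * t * E ^ 2))) - 2 * (1 - δ) + 1) := by
  have := isProbabilityMeasure_mixtureLaw H hp0 hp1
  set B : Set ℝ := {y : ℝ | t < |y|}ᶜ with hB
  have hBm : MeasurableSet B := (measurableSet_abs_gt t).compl
  have hBt : ∀ {x}, x ∈ B → |x| ≤ t := fun {x} hx => by simpa [hB] using hx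
  set ℓ : ℝ → ℝ := B.indicator fun x => (likelihoodRatio H x).toReal with hℓ
  have hℓm : Measurable ℓ :=
    (measurable_likelihoodRatio H).ennreal_toReal.indicator hBm
  have hℓ0 : ∀ x, 0 ≤ ℓ x := fun x => Set.indicator_nonneg (fun _ _ => ENNReal.toReal_nonneg) x
  have hℓbd : ∀ x, ℓ x ≤ E * Real.exp (t ^ 2 / 4) := by
    intro x
    by_cases hx : x ∈ B
    · rw [hℓ, Set.indicator_of_mem hx]
      refine (ENNReal.toReal_le_of_le_ofReal (by positivity) (hbd x (hBt hx))).trans ?_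
      have := hBt hx
      gcongr E * Real.exp (?_ / 4)
      exact sq_le_sq' (by linarith [abs_le.1 this]) (abs_le.1 this).2
    · rw [hℓ, Set.indicator_of_notMem hx]
      positivity
  -- This is the density of the mixture restricted to [-t, t] with respect to the standard normal
  -- law.
  set f : ℝ → ℝ := fun x => B.indicator (fun _ => 1 - p) x + p * ℓ x with hf
  have hfm : Measurable f := (measurable_const.indicator hBm).add (hℓm.const_mul p)
  have hind0 : ∀ x, 0 ≤ B.indicator (fun _ => 1 - p) x :=
    fun x => Set.indicator_nonneg (fun _ _ => by linarith) x
  have hind1 : ∀ x, B.indicator (fun _ => 1 - p) x ≤ 1 - p := fun x =>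
    Set.indicator_le_self' (fun _ _ => by linarith) x
  have hf0 : ∀ x, 0 ≤ f x := fun x => add_nonneg (hind0 x) (mul_nonneg hp0 (hℓ0 x))
  have hℓL : MemLp ℓ 2 (gaussianReal 0 1) :=
    MemLp.of_bound hℓm.aestronglyMeasurable (E * Real.exp (t ^ 2 / 4))
      (ae_of_all _ fun x => by rw [Real.norm_of_nonneg (hℓ0 x)]; exact hℓbd x)
  have hℓi : Integrable ℓ (gaussianReal 0 1) := hℓL.integrable one_le_two
  have hfL : MemLp f 2 (gaussianReal 0 1) :=
    (MemLp.indicator hBm (memLp_const (1 - p))).add (hℓL.const_mul p)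
  have hQ : (mixtureLaw p H).restrict B =
      (gaussianReal 0 1).withDensity fun x => ENNReal.ofReal (f x) := by
    have hdens : (fun x => ENNReal.ofReal (f x)) =
        B.indicator (fun x => ENNReal.ofReal (1 - p) + ENNReal.ofReal p * likelihoodRatio H x) := by
      ext x
      by_cases hx : x ∈ B
      · simp only [hf, hℓ, Set.indicator_of_mem hx]
        have hfin : likelihoodRatio H x ≠ ⊤ :=
          ((hbd x (hBt hx)).trans_lt ENNReal.ofReal_lt_top).ne
        rw [ENNReal.ofReal_add (by linarith) (mul_nonneg hp0 ENNReal.toReal_nonneg),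
          ENNReal.ofReal_mul hp0, ENNReal.ofReal_toReal hfin]
      · simp [hf, hℓ, Set.indicator_of_notMem hx]
    rw [hdens, withDensity_indicator hBm, ← restrict_withDensity hBm, mixtureLaw,
      conv_gaussian_eq_withDensity]
    congr 1
    have hadd := withDensity_add_left (μ := gaussianReal 0 1)
      (f := fun _ => ENNReal.ofReal (1 - p)) measurable_const
      (fun x => ENNReal.ofReal p * likelihoodRatio H x)
    have hsmul := withDensity_smul (μ := gaussianReal 0 1) (ENNReal.ofReal p)
      (measurable_likelihoodRatio H)
    rw [withDensity_const] at hadd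
    rw [← hsmul]
    exact hadd.symm
  have hintℓ : ∫ x, ℓ x ∂(gaussianReal 0 1) ≤ 1 := by
    have h1 : ∫⁻ x, ENNReal.ofReal (ℓ x) ∂(gaussianReal 0 1) ≤ 1 := by
      calc _ ≤ ∫⁻ x, likelihoodRatio H x ∂(gaussianReal 0 1) := by
            refine lintegral_mono fun x => ?_
            by_cases hx : x ∈ B
            · rw [hℓ, Set.indicator_of_mem hx]
              exact ENNReal.ofReal_toReal_le
            · simp [hℓ, Set.indicator_of_notMem hx]
        _ = 1 := by
            rw [← setLIntegral_univ, ← withDensity_apply _ MeasurableSet.univ,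
              ← conv_gaussian_eq_withDensity, measure_univ]
    rw [integral_eq_lintegral_of_nonneg_ae (ae_of_all _ hℓ0) hℓm.aestronglyMeasurable]
    exact ENNReal.toReal_mono ENNReal.one_ne_top h1
  have hintf : ∫ x, f x ^ 2 ∂(gaussianReal 0 1) ≤ 1 + p ^ 2 * (2 * t * E ^ 2) := by
    -- As ℓ has integral at most 1, the first two terms integrate to at most 1 - p² ≤ 1; only p²
    -- times the second moment of ℓ is a genuine excess.
    have hpt : ∀ x, f x ^ 2 ≤ (1 - p) ^ 2 + 2 * (1 - p) * p * ℓ x + p ^ 2 * ℓ x ^ 2 := by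
      intro x
      have h1 : f x ≤ (1 - p) + p * ℓ x := by
        simp only [hf]
        linarith [hind1 x]
      calc f x ^ 2 ≤ ((1 - p) + p * ℓ x) ^ 2 := pow_le_pow_left₀ (hf0 x) h1 2
        _ = _ := by ring
    have hi1 : Integrable (fun x => (1 - p) ^ 2 + 2 * (1 - p) * p * ℓ x) (gaussianReal 0 1) :=
      (integrable_const _).add (hℓi.const_mul _)
    have hi2 : Integrable (fun x => p ^ 2 * ℓ x ^ 2) (gaussianReal 0 1) :=
      hℓL.integrable_sq.const_mul _
    refine (integral_mono hfL.integrable_sq (hi1.add hi2) hpt).trans ?_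
    simp only [Pi.add_apply]
    rw [integral_add hi1 hi2, integral_add (integrable_const _) (hℓi.const_mul _),
      integral_const_mul, integral_const_mul]
    have h2 := mul_le_mul_of_nonneg_left (integral_truncated_sq_le H ht hE hbd) (sq_nonneg p)
    have h3 := mul_le_mul_of_nonneg_left hintℓ
      (by nlinarith : 0 ≤ 2 * (1 - p) * p)
    simp only [integral_const, probReal_univ, one_smul]
    nlinarith
  have hq : (mixtureLaw p H).real B = 1 - (mixtureLaw p H).real {y | t < |y|} :=
    probReal_compl_eq_one_sub (measurableSet_abs_gt t)
  have hqn : 1 - δ ≤ (mixtureLaw p H).real B ^ n := by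
    rw [hq]
    exact le_trans (by linarith) (one_sub_mul_le_one_sub_pow measureReal_le_one n)
  refine (tvDist_pi_le hBm hf0 hfL hQ).trans (add_le_add (by linarith) (Real.sqrt_le_sqrt ?_))
  have hpow : (∫ x, f x ^ 2 ∂(gaussianReal 0 1)) ^ n ≤
      Real.exp (n * (p ^ 2 * (2 * t * E ^ 2))) := by
    rw [Real.exp_nat_mul]
    refine pow_le_pow_left₀ (integral_nonneg fun x => sq_nonneg _) (hintf.trans ?_) n
    linarith [Real.add_one_le_exp (p ^ 2 * (2 * t * E ^ 2))]
  linarith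

variable {G : ℕ → Measure ℝ} [∀ n, IsProbabilityMeasure (G n)] {b β K : ℝ}

/-- Both error terms are exponentials of a quadratic in t with leading coefficient a negative
multiple of β - b: the expected number of exceedances and the excess second moment. -/
theorem tendsto_tvDist_zero (hβ0 : 0 ≤ β) (hβ : b < β)
    (hup : ∀ᶠ n : ℕ in atTop, (Measure.conv (G n) (gaussianReal 0 1)).real {y | sqrtTwoLog n < |y|} ≤
      Real.exp ((b - 1) * sqrtTwoLog n ^ 2 / 2 + K * sqrtTwoLog n))
    (hlr : ∀ᶠ n : ℕ in atTop, ∀ x, |x| ≤ sqrtTwoLog n → likelihoodRatio (G n) x ≤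
      ENNReal.ofReal (Real.exp (x ^ 2 / 4 + (2 * b - 1) * sqrtTwoLog n ^ 2 / 4 + K * sqrtTwoLog n))) :
    Tendsto (fun n : ℕ => tvDist (nullLaw n) (altLaw G β n)) atTop (𝓝 0) := by
  set t := sqrtTwoLog
  set δ : ℕ → ℝ := fun n => 2 / t n + Real.exp ((b - β) / 2 * t n ^ 2 + K * t n) with hδ
  -- The exponent collects n from t²/2, p² from -βt² and E² from (2b - 1)t²/2 + 2Kt; the extra t
  -- comes from t ≤ exp t.
  set v : ℕ → ℝ := fun n => 2 * Real.exp ((b - β) * t n ^ 2 + (2 * K + 1) * t n) with hv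
  have hδ0 : Tendsto δ atTop (𝓝 0) := by
    simpa using (tendsto_sqrtTwoLog.const_div_atTop 2).add
      ((tendsto_exp_quadratic_zero (by linarith : (b - β) / 2 < 0) K).comp tendsto_sqrtTwoLog)
  have hv0 : Tendsto v atTop (𝓝 0) := by
    simpa using ((tendsto_exp_quadratic_zero (by linarith : b - β < 0) (2 * K + 1)).comp
      tendsto_sqrtTwoLog).const_mul 2
  have hlim : Tendsto (fun n => δ n + √(Real.exp (v n) - 2 * (1 - δ n) + 1)) atTop (𝓝 0) := by
    have h1 := (((Real.continuous_exp.tendsto 0).comp hv0).sub ((hδ0.const_sub 1).const_mul 2)).add_const 1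
    have h2 := hδ0.add h1.sqrt
    have he : (0 : ℝ) + √(Real.exp 0 - 2 * (1 - 0) + 1) = 0 := by norm_num
    rw [he] at h2
    exact h2
  refine tendsto_of_tendsto_of_tendsto_of_le_of_le' tendsto_const_nhds hlim
    (Eventually.of_forall fun n => tvDist_nonneg) ?_
  filter_upwards [eventually_ge_atTop 1, tendsto_sqrtTwoLog.eventually_gt_atTop 0, hup, hlr]
    with n hn ht hup hlr
  set p : ℝ := (n : ℝ) ^ (-β) with hp
  have hp0 : 0 ≤ p := by positivity
  have hp1 : p ≤ 1 := natCast_rpow_neg_le_one hn hβ0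
  set E : ℝ := Real.exp ((2 * b - 1) * t n ^ 2 / 4 + K * t n) with hE
  have hmain := tvDist_pi_mixtureLaw_le (G n) (δ := δ n) n hp0 hp1 ht.le (Real.exp_pos _).le
    (E := E) (fun x hx => by
      refine (hlr x hx).trans (ENNReal.ofReal_le_ofReal (le_of_eq ?_))
      rw [hE, ← Real.exp_add]
      congr 1
      ring) (by
      rw [mixtureLaw_real_apply (G n) hp0 hp1]
      have h1 := natCast_mul_gaussianReal_abs_gt_le hn ht
      have h2 : n * (p * Real.exp ((b - 1) * t n ^ 2 / 2 + K * t n)) =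
          Real.exp ((b - β) / 2 * t n ^ 2 + K * t n) := by
        rw [hp, natCast_rpow_eq_exp hn, natCast_eq_exp hn, ← Real.exp_add, ← Real.exp_add]
        congr 1
        ring
      have h3 : n * (p * (Measure.conv (G n) (gaussianReal 0 1)).real {y | t n < |y|}) ≤
          n * (p * Real.exp ((b - 1) * t n ^ 2 / 2 + K * t n)) := by gcongr
      have h4 : 0 ≤ n * (p * (gaussianReal 0 1).real {y | t n < |y|}) := by positivity
      simp only [hδ]
      nlinarith)
  refine hmain.trans ?_
  have hle : n * (p ^ 2 * (2 * t n * E ^ 2)) ≤ v n := by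
    calc n * (p ^ 2 * (2 * t n * E ^ 2)) ≤ n * (p ^ 2 * (2 * Real.exp (t n) * E ^ 2)) := by
          gcongr
          linarith [Real.add_one_le_exp (t n)]
      _ = v n := by
          rw [hE, hp, natCast_rpow_eq_exp hn, ← Real.exp_nat_mul, ← Real.exp_nat_mul, hv]
          nth_rewrite 1 [natCast_eq_exp hn]
          rw [show ∀ a b c d : ℝ, a * (b * (2 * c * d)) = 2 * (a * b * c * d) by intros; ring,
            ← Real.exp_add, ← Real.exp_add, ← Real.exp_add]
          congr 2
          push_cast
          ring
  have := Real.exp_le_exp.2 hle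
  gcongr

/-- Tail and likelihood ratio asymptotics at the detection threshold determine the critical sparsity
level, which the max test attains. -/
theorem maxTestAttainsCriticalSparsity_of_bounds (hb0 : 0 ≤ b) (hb1 : b ≤ 1)
    (hlow : ∃ K, ∀ᶠ n : ℕ in atTop,
      Real.exp ((b - 1) * sqrtTwoLog n ^ 2 / 2 - K * sqrtTwoLog n) ≤
        (Measure.conv (G n) (gaussianReal 0 1)).real {y | sqrtTwoLog n < |y|})
    (hup : b < 1 → ∃ K, ∀ᶠ n : ℕ in atTop,
      (Measure.conv (G n) (gaussianReal 0 1)).real {y | sqrtTwoLog n < |y|} ≤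
        Real.exp ((b - 1) * sqrtTwoLog n ^ 2 / 2 + K * sqrtTwoLog n))
    (hlr : b < 1 → ∃ K, ∀ᶠ n : ℕ in atTop, ∀ x, |x| ≤ sqrtTwoLog n → likelihoodRatio (G n) x ≤
      ENNReal.ofReal
        (Real.exp (x ^ 2 / 4 + (2 * b - 1) * sqrtTwoLog n ^ 2 / 4 + K * sqrtTwoLog n))) :
    MaxTestAttainsCriticalSparsity G b := by
  obtain ⟨K, hlow⟩ := hlow
  have hzero : ∀ β : ℝ, 0 ≤ β → β < b →
      Tendsto (fun n : ℕ => (altLaw G β n).real {x | ∀ i, |x i| ≤ sqrtTwoLog n}) atTop (𝓝 0) :=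
    fun β h0 h => tendsto_altLaw_forall_abs_le h0 h hlow
  have hsep : ∀ β : ℝ, 0 ≤ β → β < b →
      Tendsto (fun n : ℕ => tvDist (nullLaw n) (altLaw G β n)) atTop (𝓝 1) :=
    fun β h0 h => tendsto_tvDist_one h0 (hzero β h0 h)
  have hmerge : ∀ β : ℝ, b < β → β ≤ 1 →
      Tendsto (fun n : ℕ => tvDist (nullLaw n) (altLaw G β n)) atTop (𝓝 0) := by
    intro β h h1
    obtain ⟨K₁, hup⟩ := hup (h.trans_le h1)
    obtain ⟨K₂, hlr⟩ := hlr (h.trans_le h1)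
    refine tendsto_tvDist_zero (K := max K₁ K₂) (hb0.trans h.le) h ?_ ?_
    · filter_upwards [hup, tendsto_sqrtTwoLog.eventually_gt_atTop 0] with n hn ht
      refine hn.trans (Real.exp_le_exp.2 ?_)
      gcongr
      exact le_max_left _ _
    · filter_upwards [hlr, tendsto_sqrtTwoLog.eventually_gt_atTop 0] with n hn ht x hx
      refine (hn x hx).trans (ENNReal.ofReal_le_ofReal (Real.exp_le_exp.2 ?_))
      gcongr
      exact le_max_right _ _
  -- Separation below b and merging above b exclude each other, so both extrema in [0, 1] are pinned
  -- to b whatever happens at β = b itself.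
  have hne : ∀ β : ℝ, Tendsto (fun n : ℕ => tvDist (nullLaw n) (altLaw G β n)) atTop (𝓝 1) →
      ¬ Tendsto (fun n : ℕ => tvDist (nullLaw n) (altLaw G β n)) atTop (𝓝 0) :=
    fun β h1 h0 => one_ne_zero (tendsto_nhds_unique h1 h0)
  set b' : unitInterval := ⟨b, hb0, hb1⟩ with hb'
  refine ⟨⟨?_, ?_⟩, fun β h0 h => hasFullAsymptoticPower_maxTest h0 (hzero β h0 h)⟩
  · suffices lowerCriticalSparsity G = b' by rw [this]
    refine le_antisymm (sSup_le fun β hβ => ?_) (le_of_forall_lt fun β hβ => ?_)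
    · by_contra hlt
      exact hne _ hβ (hmerge _ (show b < β from not_le.1 hlt) β.2.2)
    · obtain ⟨c, hc1, hc2⟩ := exists_between hβ
      exact hc1.trans_le (le_sSup (hsep c c.2.1 hc2))
  · suffices upperCriticalSparsity G = b' by rw [this]
    refine le_antisymm (le_of_forall_gt fun β hβ => ?_) (le_sInf fun β hβ => ?_)
    · obtain ⟨c, hc1, hc2⟩ := exists_between hβ
      exact (sInf_le (hmerge c hc1 c.2.2)).trans_lt hc2
    · by_contra hlt
      exact hne _ (hsep _ β.2.1 (show (β : ℝ) < b from not_le.1 hlt)) hβ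

end Merging

/-! ### Reducing scale families to integrals against g. -/

section ScaleFamily

variable {G : Measure ℝ} {g : ℝ → ℝ}

instance [IsProbabilityMeasure G] (σ : ℕ → ℝ) (n : ℕ) : IsProbabilityMeasure (scaleFamily G σ n) :=
  Measure.isProbabilityMeasure_map (by fun_prop)

/-- Replacing θx by |θ||x| makes the integrand even in θ, so a single bound in |θ| handles both
tails of g. -/
theorem likelihoodRatio_scaleFamily_le {σ : ℕ → ℝ} {n : ℕ} (hσ : 0 ≤ σ n) (x : ℝ) :
    likelihoodRatio (scaleFamily G σ n) x ≤
      ∫⁻ θ, ENNReal.ofReal (Real.exp (σ n * |θ| * |x| - (σ n * |θ|) ^ 2 / 2)) ∂G := by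
  rw [likelihoodRatio, scaleFamily, lintegral_map (by fun_prop) (by fun_prop)]
  refine lintegral_mono fun θ => ENNReal.ofReal_le_ofReal (Real.exp_le_exp.2 ?_)
  have h := le_abs_self (σ n * θ * x)
  rw [abs_mul, abs_mul, abs_of_nonneg hσ] at h
  have h2 : (σ n * |θ|) ^ 2 = (σ n * θ) ^ 2 := by rw [mul_pow, sq_abs, mul_pow]
  rw [h2]
  linarith

theorem conv_scaleFamily_real_abs_gt_le {σ : ℕ → ℝ} {n : ℕ} {t c : ℝ} (hc : 0 ≤ c)
    {h : ℝ → ENNReal} (hh : ∀ θ, gaussianReal (σ n * θ) 1 {y | t < |y|} ≤ h θ)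
    (hc' : ∫⁻ θ, h θ ∂G ≤ ENNReal.ofReal c) :
    (Measure.conv (scaleFamily G σ n) (gaussianReal 0 1)).real {y | t < |y|} ≤ c := by
  refine ENNReal.toReal_le_of_le_ofReal hc ?_
  rw [conv_gaussian_apply _ (measurableSet_abs_gt t), scaleFamily]
  exact ((lintegral_map_le (fun m => gaussianReal m 1 {y | t < |y|}) fun θ => σ n * θ).trans (lintegral_mono hh)).trans hc'

theorem gaussianReal_abs_gt_le_ofReal (m t : ℝ) {l : ℝ} (hl : 0 ≤ l) :
    gaussianReal m 1 {y | t < |y|} ≤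
      ENNReal.ofReal (2 * Real.exp (-l * t + l ^ 2 / 2 + l * |m|)) := by
  rw [← ofReal_measureReal]
  exact ENNReal.ofReal_le_ofReal (gaussianReal_abs_gt_le m t hl)

/-- The common frame for all upper bounds: the bulk |θ| ≤ A contributes at most M because G is a
probability measure, and the tail is dominated by the even function k(|θ|), whence the factor 2.
Only k has to be measurable, not h. -/
theorem lintegral_le_of_tail [IsProbabilityMeasure G] (hg_meas : Measurable g)
    (hG : G = volume.withDensity fun θ => ENNReal.ofReal (g θ))
    {h : ℝ → ENNReal} {A M : ℝ} {k : ℝ → ℝ} (hM : 0 ≤ M)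
    (hA : ∀ θ, |θ| ≤ A → h θ ≤ ENNReal.ofReal M)
    (htail : ∀ θ, A < |θ| → ENNReal.ofReal (g θ) * h θ ≤ ENNReal.ofReal (k |θ|))
    (hkm : Measurable k) (hk0 : ∀ u, A < u → 0 ≤ k u) (hk : IntegrableOn k (Set.Ioi A)) :
    ∫⁻ θ, h θ ∂G ≤ ENNReal.ofReal (M + 2 * ∫ u in Set.Ioi A, k u) := by
  set S : Set ℝ := {θ | A < |θ|}
  set κ : ℝ → ENNReal := (Set.Ioi A).indicator fun u => ENNReal.ofReal (k u) with hκ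
  have hκm : Measurable κ := hkm.ennreal_ofReal.indicator measurableSet_Ioi
  have hκint : ∫⁻ u, κ u = ENNReal.ofReal (∫ u in Set.Ioi A, k u) := by
    rw [hκ, lintegral_indicator measurableSet_Ioi, ofReal_integral_eq_lintegral_ofReal hk]
    exact (ae_restrict_iff' measurableSet_Ioi).2 (ae_of_all _ hk0)
  have hint0 : 0 ≤ ∫ u in Set.Ioi A, k u :=
    setIntegral_nonneg measurableSet_Ioi hk0
  have hsplit : ∀ θ, h θ ≤ ENNReal.ofReal M + S.indicator h θ := by
    intro θ
    by_cases hθ : θ ∈ S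
    · rw [Set.indicator_of_mem hθ]; exact le_add_self
    · rw [Set.indicator_of_notMem hθ, add_zero]; exact hA θ (not_lt.1 hθ)
  have htail' : ∫⁻ θ, S.indicator h θ ∂G ≤ ∫⁻ θ, (κ θ + κ (-θ)) := by
    rw [hG]
    refine (lintegral_withDensity_le_lintegral_mul _ hg_meas.ennreal_ofReal _).trans
      (lintegral_mono fun θ => ?_)
    by_cases hθ : θ ∈ S
    · simp only [Pi.mul_apply, Set.indicator_of_mem hθ]
      refine (htail θ hθ).trans ?_
      have hκθ : κ |θ| = ENNReal.ofReal (k |θ|) := Set.indicator_of_mem (s := Set.Ioi A) hθ _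
      rw [← hκθ]
      rcases abs_choice θ with h1 | h1 <;> rw [h1]
      · exact le_self_add
      · exact le_add_self
    · simp [Set.indicator_of_notMem hθ]
  calc ∫⁻ θ, h θ ∂G ≤ ∫⁻ θ, (ENNReal.ofReal M + S.indicator h θ) ∂G := lintegral_mono hsplit
    _ = ENNReal.ofReal M + ∫⁻ θ, S.indicator h θ ∂G := by
        rw [lintegral_add_left measurable_const, lintegral_const, measure_univ, mul_one]
    _ ≤ ENNReal.ofReal M + ∫⁻ θ, (κ θ + κ (-θ)) := by gcongr
    _ = _ := by
        rw [lintegral_add_left hκm, lintegral_neg_eq_self (μ := volume) κ, hκint,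
          ← ENNReal.ofReal_add hint0 hint0, ← ENNReal.ofReal_add hM (by linarith), ← two_mul]

/-- The common frame for all lower bounds: the signal is drawn from a window (a, a+w] where g is at
least m, and the noise above s supplies the rest of t. -/
theorem le_conv_scaleFamily_real_abs_gt [IsProbabilityMeasure G] (hg_meas : Measurable g)
    (hG : G = volume.withDensity fun θ => ENNReal.ofReal (g θ)) {σ : ℕ → ℝ} {n : ℕ}
    {a s t w m : ℝ} (hσ : 0 < σ n) (hs : 0 ≤ s) (hm : 0 ≤ m)
    (hg : ∀ θ ∈ Set.Ioc a (a + w), m ≤ g θ) (ht : t ≤ σ n * a + s) :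
    m * w * ((√(2 * Real.pi))⁻¹ * Real.exp (-(s + 1) ^ 2 / 2)) ≤
      (Measure.conv (scaleFamily G σ n) (gaussianReal 0 1)).real {y | t < |y|} := by
  have h1 : m * w ≤ (scaleFamily G σ n).real (Set.Ioi (σ n * a)) := by
    have hpre : (fun θ => σ n * θ) ⁻¹' Set.Ioi (σ n * a) = Set.Ioi a := by
      ext θ
      exact mul_lt_mul_iff_right₀ hσ
    rw [scaleFamily, map_measureReal_apply (by fun_prop) measurableSet_Ioi, hpre]
    have h2 : ENNReal.ofReal (m * w) ≤ G (Set.Ioc a (a + w)) := by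
      rw [hG, withDensity_apply _ measurableSet_Ioc]
      calc ENNReal.ofReal (m * w) = ∫⁻ θ in Set.Ioc a (a + w), ENNReal.ofReal m := by
            rw [setLIntegral_const, Real.volume_Ioc, ENNReal.ofReal_mul hm, add_sub_cancel_left]
        _ ≤ _ := setLIntegral_mono hg_meas.ennreal_ofReal
            fun θ hθ => ENNReal.ofReal_le_ofReal (hg θ hθ)
    have h3 : m * w ≤ G.real (Set.Ioc a (a + w)) :=
      (ENNReal.ofReal_le_iff_le_toReal (measure_ne_top _ _)).1 h2
    exact h3.trans (measureReal_mono fun x hx => hx.1)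
  exact (mul_le_mul h1 (le_gaussianReal_Ioi hs) (by positivity) measureReal_nonneg).trans
    (mul_le_conv_gaussian_abs_gt _ ht)

end ScaleFamily

/-! ### Asymptotic tail hypotheses turned into explicit inequalities. -/

section TailBounds

variable {g k : ℝ → ℝ}

theorem exists_tail_bound (hk : ∀ᶠ θ in atTop, 0 ≤ k θ) (h1 : g =O[atTop] k)
    (h2 : (fun θ => g (-θ)) =O[atTop] k) :
    ∃ A C : ℝ, 0 ≤ A ∧ 0 ≤ C ∧ ∀ θ, A < |θ| → g θ ≤ C * k |θ| := by
  obtain ⟨C₁, hC₁⟩ := h1.bound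
  obtain ⟨C₂, hC₂⟩ := h2.bound
  obtain ⟨A, hA⟩ := eventually_atTop.1 (hC₁.and (hC₂.and hk))
  refine ⟨max A 0, max (max C₁ C₂) 0, le_max_right _ _, le_max_right _ _, fun θ hθ => ?_⟩
  obtain ⟨b1, b2, b3⟩ := hA |θ| ((le_max_left _ _).trans hθ.le)
  rw [Real.norm_of_nonneg b3] at b1 b2
  rcases abs_choice θ with h | h
  · rw [h] at b1 b3 ⊢
    refine ((le_abs_self _).trans b1).trans ?_
    gcongr
    exact (le_max_left _ _).trans (le_max_left _ _)
  · rw [h] at b2 b3 ⊢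
    rw [neg_neg] at b2
    refine ((le_abs_self _).trans b2).trans ?_
    gcongr
    exact (le_max_right _ _).trans (le_max_left _ _)

theorem exists_lower_tail_bound (hg : ∀ θ, 0 ≤ g θ) (h : k =O[atTop] g) :
    ∃ A c : ℝ, 0 < A ∧ 0 < c ∧ ∀ θ, A ≤ θ → c * k θ ≤ g θ := by
  obtain ⟨C, hC, hCb⟩ := h.exists_pos
  obtain ⟨A, hA⟩ := eventually_atTop.1 hCb.bound
  refine ⟨max A 1, C⁻¹, by positivity, by positivity, fun θ hθ => ?_⟩
  have := hA θ ((le_max_left _ _).trans hθ)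
  rw [Real.norm_of_nonneg (hg θ)] at this
  rw [inv_mul_le_iff₀ hC]
  exact (le_abs_self _).trans this

theorem integrable_exp_neg_mul_sub_sq {c : ℝ} (hc : 0 < c) (m : ℝ) :
    Integrable fun u : ℝ => Real.exp (-c * (u - m) ^ 2) :=
  (integrable_exp_neg_mul_sq hc).comp_sub_right m

theorem setIntegral_exp_neg_mul_sub_sq_le {c : ℝ} (hc : 0 < c) (m A : ℝ) :
    ∫ u in Set.Ioi A, Real.exp (-c * (u - m) ^ 2) ≤ √(Real.pi / c) := by
  refine (setIntegral_le_integral (integrable_exp_neg_mul_sub_sq hc m)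
    (ae_of_all _ fun _ => (Real.exp_pos _).le)).trans (le_of_eq ?_)
  rw [integral_sub_right_eq_self (fun u : ℝ => Real.exp (-c * u ^ 2)) m, integral_gaussian]

theorem eventually_le_exp_sqrtTwoLog (C : ℝ) :
    ∀ᶠ n : ℕ in atTop, C ≤ Real.exp (sqrtTwoLog n) :=
  (Real.tendsto_exp_atTop.comp tendsto_sqrtTwoLog).eventually_ge_atTop C

theorem eventually_exp_neg_sqrtTwoLog_le {c : ℝ} (hc : 0 < c) :
    ∀ᶠ n : ℕ in atTop, Real.exp (-sqrtTwoLog n) ≤ c :=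
  (Real.tendsto_exp_neg_atTop_nhds_zero.comp tendsto_sqrtTwoLog).eventually_le_const hc

end TailBounds

/-! ### Gaussian tails. -/

section GaussianTail

variable {G : Measure ℝ} [IsProbabilityMeasure G] {g : ℝ → ℝ} {r γ γ' : ℝ}

/-- To the right of both centres, the Gaussian profile with the larger centre dominates the other,
so one profile serves for both tails. -/
theorem exists_gaussian_tail_bound
    (h1 : g =O[atTop] fun θ : ℝ => Real.exp (-(θ - γ) ^ 2 / 2))
    (h2 : (fun θ => g (-θ)) =O[atTop] fun θ : ℝ => Real.exp (-(θ - γ') ^ 2 / 2)) :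
    ∃ A C : ℝ, 0 ≤ A ∧ 0 ≤ C ∧
      ∀ θ, A < |θ| → g θ ≤ C * Real.exp (-(|θ| - max γ γ') ^ 2 / 2) := by
  have hmono : ∀ c ≤ max γ γ', (fun θ : ℝ => Real.exp (-(θ - c) ^ 2 / 2)) =O[atTop]
      fun θ : ℝ => Real.exp (-(θ - max γ γ') ^ 2 / 2) := by
    intro c hc
    refine IsBigO.of_bound 1 ?_
    filter_upwards [eventually_ge_atTop (max γ γ')] with θ hθ
    rw [Real.norm_of_nonneg (Real.exp_pos _).le, Real.norm_of_nonneg (Real.exp_pos _).le, one_mul]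
    apply Real.exp_le_exp.2
    nlinarith
  exact exists_tail_bound (k := fun θ => Real.exp (-(θ - max γ γ') ^ 2 / 2))
    (Eventually.of_forall fun θ => (Real.exp_pos _).le)
    (h1.trans (hmono γ (le_max_left _ _))) (h2.trans (hmono γ' (le_max_right _ _)))

/-- Minimising θ²/2 + s²/2 subject to rθ + s = t gives θ = rt/q and s = t/q with q = r² + 1, at cost
t²/(2q); this matches 1 - b = 1/q. -/
theorem gaussian_tail_lower (hg_meas : Measurable g) (hg_nonneg : ∀ θ, 0 ≤ g θ)
    (hG : G = volume.withDensity fun θ => ENNReal.ofReal (g θ)) (hr : 0 < r)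
    (h : (fun θ : ℝ => Real.exp (-(θ - γ) ^ 2 / 2)) =O[atTop] g) :
    ∃ K, ∀ᶠ n : ℕ in atTop,
      Real.exp ((r ^ 2 / (r ^ 2 + 1) - 1) * sqrtTwoLog n ^ 2 / 2 - K * sqrtTwoLog n) ≤
        (Measure.conv (scaleFamily G (fun _ => r) n) (gaussianReal 0 1)).real
          {y | sqrtTwoLog n < |y|} := by
  obtain ⟨A, c, hA, hc, hlow⟩ := exists_lower_tail_bound hg_nonneg h
  have hc' : 0 < c * (√(2 * Real.pi))⁻¹ := by positivity
  set q : ℝ := r ^ 2 + 1 with hq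
  have hq0 : 0 < q := by positivity
  -- The terms linear in t from expanding both squares, the constants multiplied by t ≥ 1, and one t
  -- that absorbs the prefactor.
  refine ⟨r / q * |1 - γ| + 1 / q + (1 - γ) ^ 2 / 2 + 2, ?_⟩
  filter_upwards [eventually_exp_neg_sqrtTwoLog_le hc',
    tendsto_sqrtTwoLog.eventually_ge_atTop 1,
    (tendsto_sqrtTwoLog.const_mul_atTop (show 0 < r / q by positivity)).eventually_ge_atTop A,
    (tendsto_sqrtTwoLog.const_mul_atTop (show 0 < r / q by positivity)).eventually_ge_atTop γ]
    with n hn1 hn2 hn3 hn4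
  set t := sqrtTwoLog n
  have hmain := le_conv_scaleFamily_real_abs_gt hg_meas hG (σ := fun _ => r) (n := n) (t := t)
    (a := r / q * t) (s := t / q) (w := 1)
    (m := c * Real.exp (-(r / q * t + 1 - γ) ^ 2 / 2)) hr (by positivity) (by positivity)
    (fun θ hθ => by
      refine le_trans ?_ (hlow θ (hn3.trans hθ.1.le))
      have h1 := hθ.1
      have h2 := hθ.2
      gcongr
      linarith)
    (le_of_eq (by field_simp; rw [hq]))
  refine le_trans ?_ hmain
  have hgq : r / q * t * (1 - γ) ≤ r / q * t * |1 - γ| :=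
    mul_le_mul_of_nonneg_left (le_abs_self _) (by positivity)
  calc Real.exp ((r ^ 2 / q - 1) * t ^ 2 / 2 -
        (r / q * |1 - γ| + 1 / q + (1 - γ) ^ 2 / 2 + 2) * t)
      ≤ Real.exp (-t + (-(r / q * t + 1 - γ) ^ 2 / 2 + -(t / q + 1) ^ 2 / 2)) := by
        apply Real.exp_le_exp.2
        have e1 : (r / q * t) ^ 2 + (t / q) ^ 2 = (1 - r ^ 2 / q) * t ^ 2 := by
          field_simp
          rw [hq]
          ring
        have e2 : (1 - γ) ^ 2 / 2 ≤ (1 - γ) ^ 2 / 2 * t :=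
          le_mul_of_one_le_right (by positivity) hn2
        have e3 : 1 / q * t = t / q := by ring
        nlinarith
    _ = Real.exp (-t) * (Real.exp (-(r / q * t + 1 - γ) ^ 2 / 2) *
          Real.exp (-(t / q + 1) ^ 2 / 2)) := by rw [Real.exp_add, Real.exp_add]
    _ ≤ (c * (√(2 * Real.pi))⁻¹) * (Real.exp (-(r / q * t + 1 - γ) ^ 2 / 2) *
          Real.exp (-(t / q + 1) ^ 2 / 2)) := by gcongr
    _ = _ := by ring

/-- Chernoff with parameter l integrated against the Gaussian tail gives exponent -lt + l²(1 + r²)/2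
up to O(t). Its minimum, at l = t/q, is -t²/(2q), matching the lower bound. -/
theorem gaussian_tail_upper (hg_meas : Measurable g)
    (hG : G = volume.withDensity fun θ => ENNReal.ofReal (g θ)) (hr : 0 < r) {A C γ₀ : ℝ}
    (hA : 0 ≤ A) (hC : 0 ≤ C)
    (h : ∀ θ, A < |θ| → g θ ≤ C * Real.exp (-(|θ| - γ₀) ^ 2 / 2)) :
    ∃ K, ∀ᶠ n : ℕ in atTop,
      (Measure.conv (scaleFamily G (fun _ => r) n) (gaussianReal 0 1)).real
          {y | sqrtTwoLog n < |y|} ≤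
        Real.exp ((r ^ 2 / (r ^ 2 + 1) - 1) * sqrtTwoLog n ^ 2 / 2 + K * sqrtTwoLog n) := by
  set q : ℝ := r ^ 2 + 1 with hq
  have hq0 : 0 < q := by positivity
  have hq1 : 1 ≤ q := by nlinarith
  set D : ℝ := √(Real.pi / (1 / 2)) with hD
  have hD0 : 0 ≤ D := Real.sqrt_nonneg _
  refine ⟨r / q * (A + |γ₀|) + 1, ?_⟩
  filter_upwards [eventually_le_exp_sqrtTwoLog (2 + 4 * C * D),
    tendsto_sqrtTwoLog.eventually_ge_atTop 0] with n hn1 ht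
  set t := sqrtTwoLog n
  set l : ℝ := t / q with hl
  have hl0 : 0 ≤ l := by positivity
  set E : ℝ := Real.exp ((r ^ 2 / q - 1) * t ^ 2 / 2 + r / q * (A + |γ₀|) * t) with hE
  have hb : r ^ 2 / q - 1 = -(1 / q) := by field_simp; rw [hq]; ring
  have hlt : l * t = 1 / q * t ^ 2 := by rw [hl]; ring
  have hlq : l ^ 2 * q = 1 / q * t ^ 2 := by rw [hl]; field_simp
  have hA1 : 2 * Real.exp (-l * t + l ^ 2 / 2 + l * (r * A)) ≤ 2 * E := by
    refine mul_le_mul_of_nonneg_left ?_ two_pos.le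
    rw [hE, hb]
    apply Real.exp_le_exp.2
    have : 0 ≤ r / q * |γ₀| * t := by positivity
    have e : l * (r * A) = r / q * A * t := by rw [hl]; ring
    nlinarith [sq_nonneg l]
  set k : ℝ → ℝ := fun u => 2 * C * E * Real.exp (-(1 / 2) * (u - (γ₀ + l * r)) ^ 2) with hk
  have hint : IntegrableOn k (Set.Ioi A) :=
    ((integrable_exp_neg_mul_sub_sq (by norm_num) _).const_mul _).integrableOn
  have hkint : ∫ u in Set.Ioi A, k u ≤ 2 * C * E * D := by
    rw [hk, integral_const_mul]
    gcongr
    exact setIntegral_exp_neg_mul_sub_sq_le (by norm_num) _ _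
  have hmain := lintegral_le_of_tail hg_meas hG (A := A) (M := 2 * E) (k := k)
    (h := fun θ => ENNReal.ofReal (2 * Real.exp (-l * t + l ^ 2 / 2 + l * |r * θ|)))
    (by positivity)
    (fun θ hθ => by
      refine ENNReal.ofReal_le_ofReal (le_trans ?_ hA1)
      rw [abs_mul, abs_of_pos hr]
      gcongr)
    (fun θ hθ => by
      rw [← ENNReal.ofReal_mul' (by positivity)]
      apply ENNReal.ofReal_le_ofReal
      rw [abs_mul, abs_of_pos hr]
      set u := |θ|
      calc g θ * (2 * Real.exp (-l * t + l ^ 2 / 2 + l * (r * u)))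
          ≤ C * Real.exp (-(u - γ₀) ^ 2 / 2) *
              (2 * Real.exp (-l * t + l ^ 2 / 2 + l * (r * u))) := by
            gcongr
            exact h θ hθ
        _ = 2 * C * Real.exp (-(u - γ₀) ^ 2 / 2 + (-l * t + l ^ 2 / 2 + l * (r * u))) := by
            rw [Real.exp_add (-(u - γ₀) ^ 2 / 2)]; ring
        _ ≤ 2 * C * Real.exp ((r ^ 2 / q - 1) * t ^ 2 / 2 + r / q * (A + |γ₀|) * t +
              -(1 / 2) * (u - (γ₀ + l * r)) ^ 2) := by
            refine mul_le_mul_of_nonneg_left (Real.exp_le_exp.2 ?_) (by positivity)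
            rw [hb]
            have h1 : 0 ≤ r / q * A * t := by positivity
            have h2 : l * r * γ₀ ≤ r / q * |γ₀| * t := by
              calc l * r * γ₀ ≤ l * r * |γ₀| := by gcongr; exact le_abs_self _
                _ = _ := by rw [hl]; ring
            nlinarith
        _ = k u := by rw [Real.exp_add, hk, hE]; ring)
    (by fun_prop) (fun u _ => by positivity) hint
  refine (conv_scaleFamily_real_abs_gt_le (c := 2 * E + 2 * (2 * C * E * D)) (by positivity)
    (fun θ => gaussianReal_abs_gt_le_ofReal _ _ hl0)
    (hmain.trans (ENNReal.ofReal_le_ofReal (by linarith)))).trans ?_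
  calc 2 * E + 2 * (2 * C * E * D) = E * (2 + 4 * C * D) := by ring
    _ ≤ E * Real.exp t := by gcongr
    _ = _ := by rw [hE, ← Real.exp_add]; congr 1; ring

/-- Completing the square in u leaves exp(bx²/2) up to exp(O(t)), with b = r²/q. Since bx²/2 = x²/4
+ (2b - 1)x²/4 and r > 1 makes 2b - 1 nonnegative, x² may be replaced by t² in the last term. -/
theorem gaussian_likelihoodRatio_upper (hg_meas : Measurable g)
    (hG : G = volume.withDensity fun θ => ENNReal.ofReal (g θ)) (hr : 1 < r) {A C γ₀ : ℝ}
    (hA : 0 ≤ A) (hC : 0 ≤ C)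
    (h : ∀ θ, A < |θ| → g θ ≤ C * Real.exp (-(|θ| - γ₀) ^ 2 / 2)) :
    ∃ K, ∀ᶠ n : ℕ in atTop, ∀ x, |x| ≤ sqrtTwoLog n →
      likelihoodRatio (scaleFamily G (fun _ => r) n) x ≤ ENNReal.ofReal (Real.exp
        (x ^ 2 / 4 + (2 * (r ^ 2 / (r ^ 2 + 1)) - 1) * sqrtTwoLog n ^ 2 / 4 +
          K * sqrtTwoLog n)) := by
  set q : ℝ := r ^ 2 + 1 with hq
  have hq0 : 0 < q := by positivity
  have hq1 : 1 ≤ q := by nlinarith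
  have hb : 0 ≤ 2 * (r ^ 2 / q) - 1 := by
    rw [sub_nonneg, mul_div_assoc', le_div_iff₀ hq0]
    nlinarith
  have hr0 : 0 < r := by linarith
  set D : ℝ := √(Real.pi / (q / 2)) with hD
  have hD0 : 0 ≤ D := Real.sqrt_nonneg _
  refine ⟨r * A + r / q * |γ₀| + 1, ?_⟩
  filter_upwards [eventually_le_exp_sqrtTwoLog (1 + 2 * C * D),
    tendsto_sqrtTwoLog.eventually_ge_atTop 0] with n hn1 ht x hx
  set t := sqrtTwoLog n
  set E : ℝ := Real.exp (x ^ 2 / 4 + (2 * (r ^ 2 / q) - 1) * t ^ 2 / 4 +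
    (r * A + r / q * |γ₀|) * t) with hE
  have hxt : x ^ 2 ≤ t ^ 2 := by
    rw [← sq_abs]
    exact pow_le_pow_left₀ (abs_nonneg x) hx 2
  set X := |x| with hX
  have hX0 : 0 ≤ X := abs_nonneg x
  have hXx : X ^ 2 = x ^ 2 := sq_abs x
  set m : ℝ := (r * X + γ₀) / q with hm
  set k : ℝ → ℝ := fun u => C * E * Real.exp (-(q / 2) * (u - m) ^ 2) with hk
  have hint : IntegrableOn k (Set.Ioi A) :=
    ((integrable_exp_neg_mul_sub_sq (by positivity) _).const_mul _).integrableOn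
  have hkint : ∫ u in Set.Ioi A, k u ≤ C * E * D := by
    rw [hk, integral_const_mul]
    gcongr
    exact setIntegral_exp_neg_mul_sub_sq_le (by positivity) _ _
  have hbt : 0 ≤ (2 * (r ^ 2 / q) - 1) * t ^ 2 / 4 := by positivity
  have hgt : 0 ≤ r / q * |γ₀| * t := by positivity
  have hmain := lintegral_le_of_tail hg_meas hG (A := A) (M := E) (k := k)
    (h := fun θ => ENNReal.ofReal (Real.exp (r * |θ| * X - (r * |θ|) ^ 2 / 2)))
    (by positivity)
    (fun θ hθ => by
      refine ENNReal.ofReal_le_ofReal (Real.exp_le_exp.2 ?_)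
      have h1 : r * |θ| * X ≤ r * A * t := by gcongr
      nlinarith [sq_nonneg (r * |θ|), sq_nonneg x])
    (fun θ hθ => by
      rw [← ENNReal.ofReal_mul' (by positivity)]
      apply ENNReal.ofReal_le_ofReal
      set u := |θ|
      calc g θ * Real.exp (r * u * X - (r * u) ^ 2 / 2)
          ≤ C * Real.exp (-(u - γ₀) ^ 2 / 2) * Real.exp (r * u * X - (r * u) ^ 2 / 2) := by
            gcongr
            exact h θ hθ
        _ = C * Real.exp (-(u - γ₀) ^ 2 / 2 + (r * u * X - (r * u) ^ 2 / 2)) := by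
            rw [Real.exp_add]; ring
        _ ≤ C * Real.exp (x ^ 2 / 4 + (2 * (r ^ 2 / q) - 1) * t ^ 2 / 4 +
              (r * A + r / q * |γ₀|) * t + -(q / 2) * (u - m) ^ 2) := by
            refine mul_le_mul_of_nonneg_left (Real.exp_le_exp.2 ?_) hC
            have e1 : -(u - γ₀) ^ 2 / 2 + (r * u * X - (r * u) ^ 2 / 2) =
                -(q / 2) * (u - m) ^ 2 + (r * X + γ₀) ^ 2 / (2 * q) - γ₀ ^ 2 / 2 := by
              rw [hm]
              field_simp
              rw [hq]
              ring
            have e2 : (r * X + γ₀) ^ 2 / (2 * q) =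
                r ^ 2 / q * x ^ 2 / 2 + r / q * γ₀ * X + γ₀ ^ 2 / 2 * (1 / q) := by
              rw [← hXx]
              field_simp
              ring
            have e3 : γ₀ ^ 2 / 2 * (1 / q) ≤ γ₀ ^ 2 / 2 :=
              mul_le_of_le_one_right (by positivity) ((div_le_one hq0).2 hq1)
            have e4 : r / q * γ₀ * X ≤ r / q * |γ₀| * t := by
              calc r / q * γ₀ * X ≤ r / q * |γ₀| * X := by gcongr; exact le_abs_self _
                _ ≤ _ := by gcongr
            have e5 : (2 * (r ^ 2 / q) - 1) * x ^ 2 ≤ (2 * (r ^ 2 / q) - 1) * t ^ 2 := by gcongr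
            have e6 : 0 ≤ r * A * t := by positivity
            linarith
        _ = k u := by rw [Real.exp_add, hk, hE]; ring)
    (by fun_prop) (fun u _ => by positivity) hint
  refine (likelihoodRatio_scaleFamily_le hr0.le x).trans (hmain.trans
    (ENNReal.ofReal_le_ofReal ?_))
  calc E + 2 * ∫ u in Set.Ioi A, k u ≤ E * (1 + 2 * C * D) := by linarith
    _ ≤ E * Real.exp t := by gcongr
    _ = _ := by rw [hE, ← Real.exp_add]; congr 1; ring

theorem maxTestAttainsCriticalSparsity_gaussian (hg_meas : Measurable g)
    (hg_nonneg : ∀ θ, 0 ≤ g θ)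
    (hG : G = volume.withDensity fun θ => ENNReal.ofReal (g θ)) (hr : 1 < r)
    (h1 : g =Θ[atTop] fun θ : ℝ => Real.exp (-(θ - γ) ^ 2 / 2))
    (h2 : (fun θ => g (-θ)) =O[atTop] fun θ : ℝ => Real.exp (-(θ - γ') ^ 2 / 2)) :
    MaxTestAttainsCriticalSparsity (scaleFamily G fun _ => r) (r ^ 2 / (r ^ 2 + 1)) := by
  obtain ⟨A, C, hA, hC, hbd⟩ := exists_gaussian_tail_bound h1.1 h2
  have hr0 : 0 < r := by linarith
  exact maxTestAttainsCriticalSparsity_of_bounds (by positivity)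
    ((div_le_one (by positivity)).2 (by linarith))
    (gaussian_tail_lower hg_meas hg_nonneg hG hr0 h1.2)
    (fun _ => gaussian_tail_upper hg_meas hG hr0 hA hC hbd)
    (fun _ => gaussian_likelihoodRatio_upper hg_meas hG hr hA hC hbd)

end GaussianTail

/-! ### Exponential tails, with d = 1/r and σ_n = 1/(dt). -/

section ExponentialTail

variable {G : Measure ℝ} [IsProbabilityMeasure G] {g : ℝ → ℝ} {d : ℝ} {σ : ℕ → ℝ}

/-- A signal μ costs μ/σ_n = dtμ, linearly, and the noise costs (t - μ)²/2. The optimum leaves noise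
dt and signal (1 - d)t, that is θ = (1 - d)dt², at total cost (1 - (1 - d)²)t²/2. -/
theorem exponential_tail_lower (hg_meas : Measurable g) (hg_nonneg : ∀ θ, 0 ≤ g θ)
    (hG : G = volume.withDensity fun θ => ENNReal.ofReal (g θ)) (hd0 : 0 < d) (hd1 : d < 1)
    (hσ : ∀ᶠ n in atTop, σ n * (d * sqrtTwoLog n) = 1)
    (h : (fun θ : ℝ => Real.exp (-θ)) =O[atTop] g) :
    ∃ K, ∀ᶠ n : ℕ in atTop,
      Real.exp (((1 - d) ^ 2 - 1) * sqrtTwoLog n ^ 2 / 2 - K * sqrtTwoLog n) ≤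
        (Measure.conv (scaleFamily G σ n) (gaussianReal 0 1)).real {y | sqrtTwoLog n < |y|} := by
  obtain ⟨A, c, hA, hc, hlow⟩ := exists_lower_tail_bound hg_nonneg h
  have hc' : 0 < c * (√(2 * Real.pi))⁻¹ := by positivity
  have hd2 : 0 < (1 - d) * d := mul_pos (by linarith) hd0
  refine ⟨d + 3, ?_⟩
  filter_upwards [eventually_exp_neg_sqrtTwoLog_le hc',
    tendsto_sqrtTwoLog.eventually_ge_atTop 1,
    (((tendsto_pow_atTop two_ne_zero).comp tendsto_sqrtTwoLog).const_mul_atTop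
      hd2).eventually_ge_atTop A, hσ] with n hn1 hn2 hn3 hσ
  simp only [Function.comp] at hn3
  set t := sqrtTwoLog n
  have ht0 : 0 < t := by linarith
  have hσ0 : 0 < σ n := by
    by_contra hneg
    have := mul_nonpos_of_nonpos_of_nonneg (not_lt.1 hneg) (mul_pos hd0 ht0).le
    linarith
  have hmain := le_conv_scaleFamily_real_abs_gt hg_meas hG (σ := σ) (n := n) (t := t)
    (a := (1 - d) * d * t ^ 2) (s := d * t) (w := 1)
    (m := c * Real.exp (-((1 - d) * d * t ^ 2 + 1))) hσ0 (by positivity) (by positivity)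
    (fun θ hθ => by
      refine le_trans ?_ (hlow θ (hn3.trans hθ.1.le))
      have h2 := hθ.2
      gcongr)
    (by
      have : σ n * ((1 - d) * d * t ^ 2) = (1 - d) * t := by
        linear_combination (1 - d) * t * hσ
      rw [this]
      linarith)
  refine le_trans ?_ hmain
  calc Real.exp (((1 - d) ^ 2 - 1) * t ^ 2 / 2 - (d + 3) * t)
      ≤ Real.exp (-t + (-((1 - d) * d * t ^ 2 + 1) + -(d * t + 1) ^ 2 / 2)) := by
        apply Real.exp_le_exp.2
        nlinarith
    _ = Real.exp (-t) * (Real.exp (-((1 - d) * d * t ^ 2 + 1)) *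
          Real.exp (-(d * t + 1) ^ 2 / 2)) := by rw [Real.exp_add, Real.exp_add]
    _ ≤ (c * (√(2 * Real.pi))⁻¹) * (Real.exp (-((1 - d) * d * t ^ 2 + 1)) *
          Real.exp (-(d * t + 1) ^ 2 / 2)) := by gcongr
    _ = _ := by ring

/-- The natural Chernoff parameter dt would make exp(lσ_n|θ|) cancel exp(-|θ|) exactly, leaving a
non-integrable tail. -/
theorem exponential_tail_upper (hg_meas : Measurable g)
    (hG : G = volume.withDensity fun θ => ENNReal.ofReal (g θ)) (hd0 : 0 < d)
    (hσ : ∀ᶠ n in atTop, σ n * (d * sqrtTwoLog n) = 1) {A C : ℝ}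
    (hA : 0 ≤ A) (hC : 0 ≤ C) (h : ∀ θ, A < |θ| → g θ ≤ C * Real.exp (-|θ|)) :
    ∃ K, ∀ᶠ n : ℕ in atTop,
      (Measure.conv (scaleFamily G σ n) (gaussianReal 0 1)).real {y | sqrtTwoLog n < |y|} ≤
        Real.exp (((1 - d) ^ 2 - 1) * sqrtTwoLog n ^ 2 / 2 + K * sqrtTwoLog n) := by
  refine ⟨A + d + 3, ?_⟩
  filter_upwards [eventually_le_exp_sqrtTwoLog (2 + 4 * C),
    tendsto_sqrtTwoLog.eventually_ge_atTop 1, hσ] with n hn1 ht hσ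
  set t := sqrtTwoLog n
  have ht0 : 0 < t := by linarith
  have hσ0 : 0 < σ n := by
    by_contra hneg
    have := mul_nonpos_of_nonpos_of_nonneg (not_lt.1 hneg) (mul_pos hd0 ht0).le
    linarith
  -- Shrinking l by the factor 1 - e restores a decay exp(-eu), whose integral is at most t². With e
  -- = 1/t² the exponent grows by only e·dt² = d.
  set e : ℝ := (t ^ 2)⁻¹ with he
  have he0 : 0 < e := by positivity
  have he1 : e ≤ 1 := inv_le_one_of_one_le₀ (one_le_pow₀ ht)
  have het : e * t ^ 2 = 1 := inv_mul_cancel₀ (by positivity)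
  set l : ℝ := (1 - e) * (d * t) with hl
  have hl0 : 0 ≤ l := mul_nonneg (by linarith) (by positivity)
  have hlσ : ∀ θ, l * |σ n * θ| = (1 - e) * |θ| := by
    intro θ
    rw [abs_mul, abs_of_pos hσ0, hl]
    linear_combination (1 - e) * |θ| * hσ
  set E : ℝ := Real.exp (((1 - d) ^ 2 - 1) * t ^ 2 / 2 + (A + d) * t) with hE
  have hlexp : -l * t + l ^ 2 / 2 ≤ ((1 - d) ^ 2 - 1) * t ^ 2 / 2 + d * t := by
    have h1 : l ^ 2 ≤ (d * t) ^ 2 :=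
      pow_le_pow_left₀ hl0 (mul_le_of_le_one_left (by positivity) (by linarith)) 2
    have h2 : l * t = d * t ^ 2 - d := by
      rw [hl]
      linear_combination -d * het
    nlinarith
  have hexp : Real.exp (-l * t + l ^ 2 / 2 + A) ≤ E := by
    apply Real.exp_le_exp.2
    nlinarith
  set k : ℝ → ℝ := fun u => 2 * C * E * Real.exp (-e * u) with hk
  have hint : IntegrableOn k (Set.Ioi A) :=
    (integrableOn_exp_mul_Ioi (neg_lt_zero.2 he0) A).const_mul _
  have hkint : ∫ u in Set.Ioi A, k u ≤ 2 * C * E * t ^ 2 := by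
    rw [hk, integral_const_mul, integral_exp_mul_Ioi (neg_lt_zero.2 he0), neg_div_neg_eq]
    gcongr
    rw [he, div_inv_eq_mul]
    refine mul_le_of_le_one_left (by positivity) (Real.exp_le_one_iff.2 ?_)
    have : 0 ≤ (t ^ 2)⁻¹ * A := by positivity
    linarith
  have hmain := lintegral_le_of_tail hg_meas hG (A := A) (M := 2 * E) (k := k)
    (h := fun θ => ENNReal.ofReal (2 * Real.exp (-l * t + l ^ 2 / 2 + l * |σ n * θ|)))
    (by positivity)
    (fun θ hθ => by
      refine ENNReal.ofReal_le_ofReal (mul_le_mul_of_nonneg_left ?_ two_pos.le)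
      refine le_trans (Real.exp_le_exp.2 ?_) hexp
      rw [hlσ]
      nlinarith [abs_nonneg θ])
    (fun θ hθ => by
      rw [← ENNReal.ofReal_mul' (by positivity)]
      apply ENNReal.ofReal_le_ofReal
      rw [hlσ]
      set u := |θ|
      calc g θ * (2 * Real.exp (-l * t + l ^ 2 / 2 + (1 - e) * u))
          ≤ C * Real.exp (-u) * (2 * Real.exp (-l * t + l ^ 2 / 2 + (1 - e) * u)) := by
            gcongr
            exact h θ hθ
        _ = 2 * C * (Real.exp (-l * t + l ^ 2 / 2) * Real.exp (-e * u)) := by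
            rw [← Real.exp_add, show C * Real.exp (-u) * (2 * Real.exp (-l * t + l ^ 2 / 2 +
              (1 - e) * u)) = 2 * C * (Real.exp (-u) * Real.exp (-l * t + l ^ 2 / 2 +
              (1 - e) * u)) by ring, ← Real.exp_add]
            congr 2
            ring
        _ ≤ 2 * C * (E * Real.exp (-e * u)) := by
            gcongr
            exact (Real.exp_le_exp.2 (by linarith)).trans hexp
        _ = k u := by rw [hk]; ring)
    (by fun_prop) (fun u _ => by positivity) hint
  refine (conv_scaleFamily_real_abs_gt_le (c := 2 * E + 2 * (2 * C * E * t ^ 2)) (by positivity)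
    (fun θ => gaussianReal_abs_gt_le_ofReal _ _ hl0)
    (hmain.trans (ENNReal.ofReal_le_ofReal (by linarith)))).trans ?_
  have ht2 : t ^ 2 ≤ Real.exp (2 * t) := by
    rw [show 2 * t = ((2 : ℕ) : ℝ) * t by norm_num, Real.exp_nat_mul]
    exact pow_le_pow_left₀ ht0.le (by linarith [Real.add_one_le_exp t]) 2
  calc 2 * E + 2 * (2 * C * E * t ^ 2) = E * (2 * 1 + 4 * C * t ^ 2) := by ring
    _ ≤ E * (2 * Real.exp (2 * t) + 4 * C * Real.exp (2 * t)) := by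
        gcongr
        exact Real.one_le_exp (by linarith)
    _ = E * (Real.exp (2 * t) * (2 + 4 * C)) := by ring
    _ ≤ E * (Real.exp (2 * t) * Real.exp t) := by gcongr
    _ = _ := by rw [hE, ← Real.exp_add, ← Real.exp_add]; congr 1; ring

/-- Since u = σ_n u · dt, the decay exp(-u) lowers X = |x| to X - dt, and completing the square
leaves exp(y²/2) with y = (X - dt)⁺, times a Gaussian in u of width of order t. -/
theorem exponential_likelihoodRatio_upper (hg_meas : Measurable g)
    (hG : G = volume.withDensity fun θ => ENNReal.ofReal (g θ)) (hd0 : 0 < d)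
    (hd : 3 * d ≤ 1) (hd2 : 1 ≤ 2 * (1 - d) ^ 2)
    (hσ : ∀ᶠ n in atTop, σ n * (d * sqrtTwoLog n) = 1) {A C : ℝ}
    (hA : 0 ≤ A) (hC : 0 ≤ C) (h : ∀ θ, A < |θ| → g θ ≤ C * Real.exp (-|θ|)) :
    ∃ K, ∀ᶠ n : ℕ in atTop, ∀ x, |x| ≤ sqrtTwoLog n →
      likelihoodRatio (scaleFamily G σ n) x ≤ ENNReal.ofReal (Real.exp
        (x ^ 2 / 4 + (2 * (1 - d) ^ 2 - 1) * sqrtTwoLog n ^ 2 / 4 + K * sqrtTwoLog n)) := by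
  set D : ℝ := √(Real.pi / (1 / 2)) with hD
  have hD0 : 0 ≤ D := Real.sqrt_nonneg _
  refine ⟨A / d + 2, ?_⟩
  filter_upwards [eventually_le_exp_sqrtTwoLog (1 + 2 * C * D * d),
    tendsto_sqrtTwoLog.eventually_ge_atTop 1, hσ] with n hn1 ht hσ x hx
  set t := sqrtTwoLog n
  have ht0 : 0 < t := by linarith
  have hσ0 : 0 < σ n := by
    by_contra hneg
    have := mul_nonpos_of_nonpos_of_nonneg (not_lt.1 hneg) (mul_pos hd0 ht0).le
    linarith
  have hσeq : σ n = 1 / (d * t) := by rw [eq_div_iff (by positivity)]; exact hσ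
  set E : ℝ := Real.exp (x ^ 2 / 4 + (2 * (1 - d) ^ 2 - 1) * t ^ 2 / 4 + A / d * t) with hE
  set X := |x| with hX
  have hX0 : 0 ≤ X := abs_nonneg x
  have hXx : X ^ 2 = x ^ 2 := sq_abs x
  set y : ℝ := max (X - d * t) 0 with hy
  have hy0 : 0 ≤ y := le_max_right _ _
  have hyX : X - d * t ≤ y := le_max_left _ _
  have hb : 0 ≤ (2 * (1 - d) ^ 2 - 1) * t ^ 2 := mul_nonneg (by linarith) (by positivity)
  -- If X ≥ dt, four times the gap is (t - X)(t + X - 4dt), nonnegative because 3d ≤ 1. Otherwise y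
  -- = 0 and 2(1 - d)² ≥ 1 suffices.
  have hyt : y ^ 2 / 2 ≤ x ^ 2 / 4 + (2 * (1 - d) ^ 2 - 1) * t ^ 2 / 4 := by
    rcases max_choice (X - d * t) 0 with h1 | h1
    · rw [hy, h1, ← hXx]
      have h2 : d * t ≤ X := by linarith [max_eq_left_iff.1 h1]
      nlinarith [mul_nonneg (sub_nonneg.2 hx) (show 0 ≤ t + X - 4 * d * t by nlinarith)]
    · rw [hy, h1]
      nlinarith [sq_nonneg x]
  have hσD : √(Real.pi / (σ n ^ 2 / 2)) = D * (d * t) := by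
    have : Real.pi / (σ n ^ 2 / 2) = Real.pi / (1 / 2) * (d * t) ^ 2 := by
      rw [hσeq]
      field_simp
    rw [this, Real.sqrt_mul (by positivity), Real.sqrt_sq (by positivity)]
  set k : ℝ → ℝ := fun u => C * E * Real.exp (-(σ n ^ 2 / 2) * (u - y / σ n) ^ 2) with hk
  have hint : IntegrableOn k (Set.Ioi A) :=
    ((integrable_exp_neg_mul_sub_sq (by positivity) _).const_mul _).integrableOn
  have hkint : ∫ u in Set.Ioi A, k u ≤ C * E * (D * (d * t)) := by
    rw [hk, integral_const_mul, ← hσD]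
    gcongr
    exact setIntegral_exp_neg_mul_sub_sq_le (by positivity) _ _
  have hAt : 0 ≤ A / d * t := by positivity
  have hmain := lintegral_le_of_tail hg_meas hG (A := A) (M := E) (k := k)
    (h := fun θ => ENNReal.ofReal (Real.exp (σ n * |θ| * X - (σ n * |θ|) ^ 2 / 2)))
    (by positivity)
    (fun θ hθ => by
      refine ENNReal.ofReal_le_ofReal (Real.exp_le_exp.2 ?_)
      have h1 : σ n * |θ| * X ≤ σ n * A * t := by gcongr
      have h2 : σ n * A * t = A / d * 1 := by rw [hσeq]; field_simp
      have h3 : A / d * 1 ≤ A / d * t := by gcongr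
      nlinarith [sq_nonneg (σ n * |θ|), sq_nonneg x])
    (fun θ hθ => by
      rw [← ENNReal.ofReal_mul' (by positivity)]
      apply ENNReal.ofReal_le_ofReal
      have hu0 : 0 ≤ |θ| := abs_nonneg θ
      have hgθ := h θ hθ
      generalize |θ| = u at hu0 hgθ ⊢
      calc g θ * Real.exp (σ n * u * X - (σ n * u) ^ 2 / 2)
          ≤ C * Real.exp (-u) * Real.exp (σ n * u * X - (σ n * u) ^ 2 / 2) := by gcongr
        _ = C * Real.exp (-u + (σ n * u * X - (σ n * u) ^ 2 / 2)) := by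
            rw [Real.exp_add (-u)]; ring
        _ ≤ C * Real.exp (x ^ 2 / 4 + (2 * (1 - d) ^ 2 - 1) * t ^ 2 / 4 + A / d * t +
              -(σ n ^ 2 / 2) * (u - y / σ n) ^ 2) := by
            refine mul_le_mul_of_nonneg_left (Real.exp_le_exp.2 ?_) hC
            have e1 : -(σ n ^ 2 / 2) * (u - y / σ n) ^ 2 = -(σ n * u - y) ^ 2 / 2 := by
              field_simp
            have e2 : σ n * u * (X - d * t) ≤ σ n * u * y := by gcongr
            have e3 : σ n * u * (d * t) = u := by linear_combination u * hσ
            rw [e1]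
            nlinarith
        _ = k u := by rw [Real.exp_add, hk, hE]; ring)
    (by fun_prop) (fun u _ => by positivity) hint
  refine (likelihoodRatio_scaleFamily_le hσ0.le x).trans (hmain.trans
    (ENNReal.ofReal_le_ofReal ?_))
  have htexp : t ≤ Real.exp t := by linarith [Real.add_one_le_exp t]
  calc E + 2 * ∫ u in Set.Ioi A, k u ≤ E * (1 + 2 * C * D * d * t) := by linarith
    _ ≤ E * (Real.exp t + 2 * C * D * d * Real.exp t) := by
        gcongr
        exact Real.one_le_exp ht0.le
    _ = E * (Real.exp t * (1 + 2 * C * D * d)) := by ring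
    _ ≤ E * (Real.exp t * Real.exp t) := by gcongr
    _ = _ := by rw [hE, ← Real.exp_add, ← Real.exp_add]; congr 1; ring

theorem maxTestAttainsCriticalSparsity_exponential (hg_meas : Measurable g)
    (hg_nonneg : ∀ θ, 0 ≤ g θ)
    (hG : G = volume.withDensity fun θ => ENNReal.ofReal (g θ)) {r : ℝ}
    (hr : √2 / (√2 - 1) < r)
    (h1 : g =Θ[atTop] fun θ : ℝ => Real.exp (-θ))
    (h2 : (fun θ => g (-θ)) =O[atTop] fun θ : ℝ => Real.exp (-θ)) :
    MaxTestAttainsCriticalSparsity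
      (scaleFamily G fun n : ℕ => r * (2 * Real.log n) ^ (-(1 / 2) : ℝ)) ((1 - 1 / r) ^ 2) := by
  have hs2 : √2 ^ 2 = 2 := Real.sq_sqrt two_pos.le
  have hs1 : 1 < √2 := by
    rw [Real.lt_sqrt one_pos.le]
    norm_num
  have hs3 : √2 < 3 / 2 := by
    rw [Real.sqrt_lt' (by norm_num)]
    norm_num
  have hr' : √2 < r * (√2 - 1) := (div_lt_iff₀ (by linarith)).1 hr
  -- The hypothesis on r amounts to (1 - 1/r)² > 1/2; the bound √2/(√2 - 1) equals 2 + √2, so it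
  -- also gives 3d ≤ 1.
  have hr3 : 3 < r := by nlinarith
  have hr0 : 0 < r := by linarith
  set d : ℝ := 1 / r with hd
  have hrd : r * d = 1 := by rw [hd]; field_simp
  have hd0 : 0 < d := by positivity
  have hd3 : 3 * d ≤ 1 := by nlinarith
  have hd1 : 1 ≤ √2 * (1 - d) := by nlinarith
  have hd2 : 1 ≤ 2 * (1 - d) ^ 2 := by
    have := one_le_pow₀ (n := 2) hd1
    rwa [mul_pow, hs2] at this
  have hσ : ∀ᶠ n : ℕ in atTop,
      (r * (2 * Real.log n) ^ (-(1 / 2) : ℝ)) * (d * sqrtTwoLog n) = 1 := by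
    filter_upwards [tendsto_sqrtTwoLog.eventually_gt_atTop 0] with n hn
    have hlog : 0 ≤ 2 * Real.log n := by
      have := Real.log_natCast_nonneg n
      positivity
    rw [Real.rpow_neg hlog, ← Real.sqrt_eq_rpow]
    change r * (sqrtTwoLog n)⁻¹ * (d * sqrtTwoLog n) = 1
    field_simp
    exact hrd
  obtain ⟨A, C, hA, hC, hbd⟩ := exists_tail_bound
    (Eventually.of_forall fun θ => (Real.exp_pos _).le) h1.1 h2
  exact maxTestAttainsCriticalSparsity_of_bounds (by positivity)
    (pow_le_one₀ (by linarith) (by linarith))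
    (exponential_tail_lower hg_meas hg_nonneg hG hd0 (by linarith) hσ h1.2)
    (fun _ => exponential_tail_upper hg_meas hG hd0 hσ hA hC hbd)
    (fun _ => exponential_likelihoodRatio_upper hg_meas hG hd0 hd3 hd2 hσ hA hC hbd)

end ExponentialTail

/-! ### Polynomial tails. -/

section PolynomialTail

variable {G : Measure ℝ} [IsProbabilityMeasure G] {g : ℝ → ℝ} {ν ρ : ℝ} {σ : ℕ → ℝ}

theorem eventually_scale_bounds (hσ : σ ~[atTop] fun n : ℕ => (n : ℝ) ^ ρ) :
    ∀ᶠ n : ℕ in atTop, Real.exp (ρ * sqrtTwoLog n ^ 2 / 2) / 2 ≤ σ n ∧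
      σ n ≤ 2 * Real.exp (ρ * sqrtTwoLog n ^ 2 / 2) := by
  have h := (isLittleO_iff.1 hσ.isLittleO) (show (0 : ℝ) < 1 / 2 by norm_num)
  filter_upwards [h, eventually_ge_atTop 1] with n hn hn1
  simp only [Pi.sub_apply] at hn
  rw [natCast_rpow_eq_exp hn1, Real.norm_of_nonneg (Real.exp_pos _).le, Real.norm_eq_abs,
    abs_le] at hn
  have := Real.exp_pos (ρ * sqrtTwoLog n ^ 2 / 2)
  constructor <;> linarith [hn.1, hn.2]

/-- For heavy tails the signal alone should cross t: no noise is asked for beyond a positive sign.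
The window (a, 2a] has G-mass at least a constant times a^{-ν}, and a is at most n^{max(-ρ, 0)} up
to exp(O(t)). -/
theorem polynomial_tail_lower (hg_meas : Measurable g) (hg_nonneg : ∀ θ, 0 ≤ g θ)
    (hG : G = volume.withDensity fun θ => ENNReal.ofReal (g θ)) (hν : 0 < ν)
    (hσ : σ ~[atTop] fun n : ℕ => (n : ℝ) ^ ρ)
    (h : (fun θ : ℝ => θ ^ (-ν - 1)) =O[atTop] g) :
    ∃ K, ∀ᶠ n : ℕ in atTop,
      Real.exp ((min (ν * ρ + 1) 1 - 1) * sqrtTwoLog n ^ 2 / 2 - K * sqrtTwoLog n) ≤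
        (Measure.conv (scaleFamily G σ n) (gaussianReal 0 1)).real {y | sqrtTwoLog n < |y|} := by
  obtain ⟨A, c, hA, hc, hlow⟩ := exists_lower_tail_bound hg_nonneg h
  set φ₀ : ℝ := (√(2 * Real.pi))⁻¹ * Real.exp (-(0 + 1) ^ 2 / 2) with hφ₀
  have hφ₀' : 0 < φ₀ := by positivity
  have hc' : 0 < c * (2 : ℝ) ^ (-ν - 1) * φ₀ := by positivity
  set κ : ℝ := max (-ρ) 0 with hκ
  have hκ0 : 0 ≤ κ := le_max_right _ _
  have hb : min (ν * ρ + 1) 1 - 1 = -(ν * κ) := by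
    rw [hκ, mul_max_of_nonneg _ _ hν.le, ← min_neg_neg, ← min_sub_sub_right]
    congr 1 <;> ring
  refine ⟨1 + 2 * ν, ?_⟩
  filter_upwards [eventually_exp_neg_sqrtTwoLog_le hc', eventually_le_exp_sqrtTwoLog (A + 2),
    tendsto_sqrtTwoLog.eventually_ge_atTop 0, eventually_scale_bounds hσ] with n hn1 hn2 ht hσn
  set t := sqrtTwoLog n
  have hσ0 : 0 < σ n := lt_of_lt_of_le (by positivity) hσn.1
  -- The term t/σ_n brings the signal to t, and A keeps the window where the lower bound on g holds,
  -- even if σ_n is large.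
  set a : ℝ := A + t / σ n with ha
  have ha0 : 0 < a := by positivity
  have hale : a ≤ Real.exp (κ * t ^ 2 / 2 + 2 * t) := by
    have h1 : t / σ n ≤ 2 * t * Real.exp (κ * t ^ 2 / 2) := by
      rw [div_le_iff₀ hσ0]
      have h2 : 1 ≤ Real.exp (κ * t ^ 2 / 2) * (2 * σ n) := by
        calc (1 : ℝ) = Real.exp 0 := Real.exp_zero.symm
          _ ≤ Real.exp (κ * t ^ 2 / 2 + ρ * t ^ 2 / 2) := by
              apply Real.exp_le_exp.2
              nlinarith [sq_nonneg t, le_max_left (-ρ) 0]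
          _ = Real.exp (κ * t ^ 2 / 2) * Real.exp (ρ * t ^ 2 / 2) := Real.exp_add _ _
          _ ≤ _ := by
              gcongr
              linarith [hσn.1]
      nlinarith [mul_le_mul_of_nonneg_left h2 ht]
    have h3 : 1 ≤ Real.exp (κ * t ^ 2 / 2) := Real.one_le_exp (by positivity)
    have h4 : t ≤ Real.exp t := by linarith [Real.add_one_le_exp t]
    have h5 : 1 ≤ Real.exp t := Real.one_le_exp ht
    calc a ≤ A * Real.exp (κ * t ^ 2 / 2) + 2 * t * Real.exp (κ * t ^ 2 / 2) := by
          have := le_mul_of_one_le_right hA.le h3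
          linarith
      _ = Real.exp (κ * t ^ 2 / 2) * (A * 1 + 2 * t) := by ring
      _ ≤ Real.exp (κ * t ^ 2 / 2) * (A * Real.exp t + 2 * Real.exp t) := by gcongr
      _ = Real.exp (κ * t ^ 2 / 2) * ((A + 2) * Real.exp t) := by ring
      _ ≤ Real.exp (κ * t ^ 2 / 2) * (Real.exp t * Real.exp t) := by gcongr
      _ = _ := by rw [← Real.exp_add, ← Real.exp_add]; congr 1; ring
  have hmain := le_conv_scaleFamily_real_abs_gt hg_meas hG (σ := σ) (n := n) (t := t)
    (a := a) (s := 0) (w := a) (m := c * (2 * a) ^ (-ν - 1)) hσ0 le_rfl (by positivity)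
    (fun θ hθ => by
      have h1 : a < θ := hθ.1
      refine le_trans ?_ (hlow θ ?_)
      · refine mul_le_mul_of_nonneg_left ?_ hc.le
        exact Real.rpow_le_rpow_of_nonpos (ha0.trans h1) (by linarith [hθ.2]) (by linarith)
      · have : 0 ≤ t / σ n := by positivity
        linarith)
    (by
      rw [ha, mul_add, mul_div_cancel₀ _ hσ0.ne']
      have : 0 ≤ σ n * A := by positivity
      linarith)
  refine le_trans ?_ hmain
  have hpow : Real.exp (-(ν * κ) * t ^ 2 / 2 - 2 * ν * t) ≤ a ^ (-ν) := by
    calc _ = Real.exp (κ * t ^ 2 / 2 + 2 * t) ^ (-ν) := by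
          rw [← Real.exp_mul]
          congr 1
          ring
      _ ≤ a ^ (-ν) := Real.rpow_le_rpow_of_nonpos ha0 hale (by linarith)
  have hpow2 : (2 * a) ^ (-ν - 1) * a = 2 ^ (-ν - 1) * a ^ (-ν) := by
    rw [Real.mul_rpow two_pos.le ha0.le, Real.rpow_sub_one ha0.ne' (-ν)]
    field_simp
  rw [hb]
  calc Real.exp (-(ν * κ) * t ^ 2 / 2 - (1 + 2 * ν) * t)
      = Real.exp (-t) * Real.exp (-(ν * κ) * t ^ 2 / 2 - 2 * ν * t) := by
        rw [← Real.exp_add]; congr 1; ring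
    _ ≤ (c * (2 : ℝ) ^ (-ν - 1) * φ₀) * a ^ (-ν) := by gcongr
    _ = _ := by rw [mul_assoc c _ a, hpow2]; ring

theorem scale_rpow_le (hν : 0 < ν) {n : ℕ} (hσ0 : 0 < σ n)
    (hσ : σ n ≤ 2 * Real.exp (ρ * sqrtTwoLog n ^ 2 / 2)) :
    σ n ^ ν ≤ 2 ^ ν * Real.exp (ν * ρ * sqrtTwoLog n ^ 2 / 2) := by
  calc σ n ^ ν ≤ (2 * Real.exp (ρ * sqrtTwoLog n ^ 2 / 2)) ^ ν :=
        Real.rpow_le_rpow hσ0.le hσ hν.le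
    _ = _ := by
        rw [Real.mul_rpow two_pos.le (Real.exp_pos _).le, ← Real.exp_mul]
        congr 2
        ring

theorem tendsto_exp_scale_zero (hρ : ρ < 0) :
    Tendsto (fun n => 2 * Real.exp (ρ * sqrtTwoLog n ^ 2 / 2)) atTop (𝓝 0) := by
  have := ((tendsto_exp_quadratic_zero (show ρ / 2 < 0 by linarith) 0).comp
    tendsto_sqrtTwoLog).const_mul 2
  rw [mul_zero] at this
  refine this.congr fun n => ?_
  simp only [Function.comp]
  congr 2
  ring

/-- The cut is at |θ| = 1/σ_n. Inside, the mean is at most 1 in absolute value and Chernoff with l =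
t costs about exp(-t²/2 + t), smaller than n^{νρ} up to exp(O(t)). Outside, the Gaussian probability
is bounded by 1 and the G-mass is O(σ_n^ν). -/
theorem polynomial_tail_upper (hg_meas : Measurable g)
    (hG : G = volume.withDensity fun θ => ENNReal.ofReal (g θ)) (hν : 0 < ν) (hρ : ρ < 0)
    (hνρ : -(1 / 2) < ν * ρ) (hσ : σ ~[atTop] fun n : ℕ => (n : ℝ) ^ ρ) {A C : ℝ}
    (hA : 0 ≤ A) (hC : 0 ≤ C) (h : ∀ θ, A < |θ| → g θ ≤ C * |θ| ^ (-ν - 1)) :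
    ∃ K, ∀ᶠ n : ℕ in atTop,
      (Measure.conv (scaleFamily G σ n) (gaussianReal 0 1)).real {y | sqrtTwoLog n < |y|} ≤
        Real.exp ((ν * ρ + 1 - 1) * sqrtTwoLog n ^ 2 / 2 + K * sqrtTwoLog n) := by
  refine ⟨2, ?_⟩
  filter_upwards [eventually_le_exp_sqrtTwoLog (2 + 2 * C * 2 ^ ν / ν),
    tendsto_sqrtTwoLog.eventually_ge_atTop 0, eventually_scale_bounds hσ,
    (tendsto_exp_scale_zero hρ).eventually_le_const (show (0 : ℝ) < 1 / (A + 1) by positivity)]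
    with n hn1 ht hσn hn2
  have hσν := scale_rpow_le hν (lt_of_lt_of_le (by positivity) hσn.1) hσn.2
  set t := sqrtTwoLog n
  have hσ0 : 0 < σ n := lt_of_lt_of_le (by positivity) hσn.1
  have hAσ : A < 1 / σ n := by
    rw [lt_div_iff₀ hσ0]
    have h1 : σ n ≤ 1 / (A + 1) := hσn.2.trans hn2
    rw [le_div_iff₀ (by linarith)] at h1
    linarith
  have hσinv : 0 < 1 / σ n := by positivity
  set E : ℝ := Real.exp ((ν * ρ + 1 - 1) * t ^ 2 / 2 + t) with hE
  set k : ℝ → ℝ := fun u => C * u ^ (-ν - 1) with hk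
  have hint : IntegrableOn k (Set.Ioi (1 / σ n)) :=
    (integrableOn_Ioi_rpow_of_lt (by linarith) hσinv).const_mul _
  have hkint : ∫ u in Set.Ioi (1 / σ n), k u ≤ C * 2 ^ ν / ν * E := by
    rw [hk, integral_const_mul, integral_Ioi_rpow_of_lt (by linarith) hσinv]
    have h1 : -(1 / σ n) ^ (-ν - 1 + 1) / (-ν - 1 + 1) = σ n ^ ν / ν := by
      rw [sub_add_cancel, neg_div_neg_eq, one_div, Real.inv_rpow hσ0.le, Real.rpow_neg hσ0.le,
        inv_inv]
    rw [h1]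
    have h2 : Real.exp (ν * ρ * t ^ 2 / 2) ≤ E := Real.exp_le_exp.2 (by linarith)
    calc C * (σ n ^ ν / ν) ≤ C * (2 ^ ν * Real.exp (ν * ρ * t ^ 2 / 2) / ν) := by gcongr
      _ ≤ C * (2 ^ ν * E / ν) := by gcongr
      _ = _ := by ring
  have hmain := lintegral_le_of_tail hg_meas hG (A := 1 / σ n) (M := 2 * E) (k := k)
    (h := fun θ => gaussianReal (σ n * θ) 1 {y | t < |y|}) (by positivity)
    (fun θ hθ => by
      refine (gaussianReal_abs_gt_le_ofReal _ _ ht).trans (ENNReal.ofReal_le_ofReal ?_)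
      refine mul_le_mul_of_nonneg_left (Real.exp_le_exp.2 ?_) two_pos.le
      have h1 : |σ n * θ| ≤ 1 := by
        rw [abs_mul, abs_of_pos hσ0]
        rw [le_div_iff₀ hσ0] at hθ
        linarith
      nlinarith [mul_le_mul_of_nonneg_left h1 ht, sq_nonneg t])
    (fun θ hθ => by
      refine (mul_le_of_le_one_right' prob_le_one).trans (ENNReal.ofReal_le_ofReal ?_)
      exact h θ (hAσ.trans hθ))
    (by fun_prop) (fun u hu => mul_nonneg hC (Real.rpow_nonneg (hσinv.trans hu).le _)) hint
  refine (conv_scaleFamily_real_abs_gt_le (c := 2 * E + 2 * (C * 2 ^ ν / ν * E)) (by positivity)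
    (fun θ => le_rfl)
    (hmain.trans (ENNReal.ofReal_le_ofReal (by linarith)))).trans ?_
  calc 2 * E + 2 * (C * 2 ^ ν / ν * E) = E * (2 + 2 * C * 2 ^ ν / ν) := by ring
    _ ≤ E * Real.exp t := by gcongr
    _ = _ := by rw [hE, ← Real.exp_add]; congr 1; ring

/-- Beyond 1/σ_n the density is at most Cσ_n^{ν+1}, and the remaining Gaussian integral contributes
exp(x²/2)/σ_n, for a total of order n^{νρ}exp(x²/2). Then x² ≤ t² turns half of x²/2 into t²/4. In
the bulk the ratio is at most exp t, which fits because νρ > -1/2. -/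
theorem polynomial_likelihoodRatio_upper (hg_meas : Measurable g)
    (hG : G = volume.withDensity fun θ => ENNReal.ofReal (g θ)) (hν : 0 < ν) (hρ : ρ < 0)
    (hνρ : -(1 / 2) < ν * ρ) (hσ : σ ~[atTop] fun n : ℕ => (n : ℝ) ^ ρ) {A C : ℝ}
    (hA : 0 ≤ A) (hC : 0 ≤ C) (h : ∀ θ, A < |θ| → g θ ≤ C * |θ| ^ (-ν - 1)) :
    ∃ K, ∀ᶠ n : ℕ in atTop, ∀ x, |x| ≤ sqrtTwoLog n →
      likelihoodRatio (scaleFamily G σ n) x ≤ ENNReal.ofReal (Real.exp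
        (x ^ 2 / 4 + (2 * (ν * ρ + 1) - 1) * sqrtTwoLog n ^ 2 / 4 + K * sqrtTwoLog n)) := by
  set D : ℝ := √(Real.pi / (1 / 2)) with hD
  have hD0 : 0 ≤ D := Real.sqrt_nonneg _
  refine ⟨2, ?_⟩
  filter_upwards [eventually_le_exp_sqrtTwoLog (1 + 2 * C * D * 2 ^ ν),
    tendsto_sqrtTwoLog.eventually_ge_atTop 0, eventually_scale_bounds hσ,
    (tendsto_exp_scale_zero hρ).eventually_le_const (show (0 : ℝ) < 1 / (A + 1) by positivity)]
    with n hn1 ht hσn hn2 x hx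
  have hσν := scale_rpow_le hν (lt_of_lt_of_le (by positivity) hσn.1) hσn.2
  set t := sqrtTwoLog n
  have hσ0 : 0 < σ n := lt_of_lt_of_le (by positivity) hσn.1
  have hAσ : A < 1 / σ n := by
    rw [lt_div_iff₀ hσ0]
    have h1 : σ n ≤ 1 / (A + 1) := hσn.2.trans hn2
    rw [le_div_iff₀ (by linarith)] at h1
    linarith
  have hσinv : 0 < 1 / σ n := by positivity
  set E : ℝ := Real.exp (x ^ 2 / 4 + (2 * (ν * ρ + 1) - 1) * t ^ 2 / 4 + t) with hE
  set X := |x| with hX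
  have hX0 : 0 ≤ X := abs_nonneg x
  have hXx : X ^ 2 = x ^ 2 := sq_abs x
  have hxt : x ^ 2 ≤ t ^ 2 := by
    rw [← hXx]
    exact pow_le_pow_left₀ hX0 hx 2
  have hbt : 0 ≤ (2 * (ν * ρ + 1) - 1) * t ^ 2 / 4 := by
    have : 0 ≤ 2 * (ν * ρ + 1) - 1 := by linarith
    positivity
  have hσD : √(Real.pi / (σ n ^ 2 / 2)) = D * (σ n)⁻¹ := by
    have : Real.pi / (σ n ^ 2 / 2) = Real.pi / (1 / 2) * (σ n)⁻¹ ^ 2 := by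
      field_simp
    rw [this, Real.sqrt_mul (by positivity), Real.sqrt_sq (by positivity)]
  set k : ℝ → ℝ := fun u => C * σ n ^ (ν + 1) * Real.exp (x ^ 2 / 2) *
    Real.exp (-(σ n ^ 2 / 2) * (u - X / σ n) ^ 2) with hk
  have hint : IntegrableOn k (Set.Ioi (1 / σ n)) :=
    ((integrable_exp_neg_mul_sub_sq (by positivity) _).const_mul _).integrableOn
  have hkint : ∫ u in Set.Ioi (1 / σ n), k u ≤ C * D * 2 ^ ν * E := by
    rw [hk, integral_const_mul]
    calc _ ≤ C * σ n ^ (ν + 1) * Real.exp (x ^ 2 / 2) * (D * (σ n)⁻¹) := by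
          rw [← hσD]
          gcongr
          exact setIntegral_exp_neg_mul_sub_sq_le (by positivity) _ _
      _ = C * D * Real.exp (x ^ 2 / 2) * σ n ^ ν := by
          rw [Real.rpow_add_one hσ0.ne']
          field_simp
      _ ≤ C * D * Real.exp (x ^ 2 / 2) * (2 ^ ν * Real.exp (ν * ρ * t ^ 2 / 2)) := by gcongr
      _ = C * D * 2 ^ ν * Real.exp (x ^ 2 / 2 + ν * ρ * t ^ 2 / 2) := by
          rw [Real.exp_add]; ring
      _ ≤ C * D * 2 ^ ν * E := by
          refine mul_le_mul_of_nonneg_left (Real.exp_le_exp.2 ?_) (by positivity)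
          linarith
  have hmain := lintegral_le_of_tail hg_meas hG (A := 1 / σ n) (M := E) (k := k)
    (h := fun θ => ENNReal.ofReal (Real.exp (σ n * |θ| * X - (σ n * |θ|) ^ 2 / 2)))
    (by positivity)
    (fun θ hθ => by
      refine ENNReal.ofReal_le_ofReal (Real.exp_le_exp.2 ?_)
      rw [le_div_iff₀ hσ0] at hθ
      have h1 : σ n * |θ| * X ≤ 1 * t := by
        gcongr
        linarith
      nlinarith [sq_nonneg (σ n * |θ|), sq_nonneg x])
    (fun θ hθ => by
      rw [← ENNReal.ofReal_mul' (by positivity)]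
      apply ENNReal.ofReal_le_ofReal
      have hgθ := h θ (hAσ.trans hθ)
      generalize |θ| = u at hθ hgθ ⊢
      have h1 : u ^ (-ν - 1) ≤ σ n ^ (ν + 1) := by
        calc u ^ (-ν - 1) ≤ (1 / σ n) ^ (-ν - 1) :=
              Real.rpow_le_rpow_of_nonpos hσinv hθ.le (by linarith)
          _ = σ n ^ (ν + 1) := by
              rw [one_div, Real.inv_rpow hσ0.le, ← Real.rpow_neg hσ0.le]
              congr 1
              ring
      calc g θ * Real.exp (σ n * u * X - (σ n * u) ^ 2 / 2)
          ≤ C * σ n ^ (ν + 1) * Real.exp (σ n * u * X - (σ n * u) ^ 2 / 2) := by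
            gcongr
            exact hgθ.trans (mul_le_mul_of_nonneg_left h1 hC)
        _ = k u := by
            rw [hk]
            simp only
            rw [mul_assoc (C * σ n ^ (ν + 1)), ← Real.exp_add, ← hXx]
            congr 2
            field_simp
            ring)
    (by fun_prop) (fun u _ => by positivity) hint
  refine (likelihoodRatio_scaleFamily_le hσ0.le x).trans (hmain.trans
    (ENNReal.ofReal_le_ofReal ?_))
  calc E + 2 * ∫ u in Set.Ioi (1 / σ n), k u ≤ E * (1 + 2 * C * D * 2 ^ ν) := by linarith
    _ ≤ E * Real.exp t := by gcongr
    _ = _ := by rw [hE, ← Real.exp_add]; congr 1; ring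

theorem maxTestAttainsCriticalSparsity_polynomial (hg_meas : Measurable g)
    (hg_nonneg : ∀ θ, 0 ≤ g θ)
    (hG : G = volume.withDensity fun θ => ENNReal.ofReal (g θ)) (hν : 0 < ν)
    (hρ : -(2 * ν)⁻¹ < ρ) (hσ : σ ~[atTop] fun n : ℕ => (n : ℝ) ^ ρ)
    (h1 : g =Θ[atTop] fun θ : ℝ => θ ^ (-ν - 1))
    (h2 : (fun θ => g (-θ)) =O[atTop] fun θ : ℝ => θ ^ (-ν - 1)) :
    MaxTestAttainsCriticalSparsity (scaleFamily G σ) (min (ν * ρ + 1) 1) := by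
  have hνρ : -(1 / 2) < ν * ρ := by
    calc -(1 / 2) = ν * -(2 * ν)⁻¹ := by field_simp
      _ < ν * ρ := mul_lt_mul_of_pos_left hρ hν
  obtain ⟨A, C, hA, hC, hbd⟩ := exists_tail_bound
    ((eventually_ge_atTop 0).mono fun θ hθ => Real.rpow_nonneg hθ _) h1.1 h2
  -- For ρ ≥ 0 the level is 1, no sparsity in [0, 1] lies above it, and only the lower bound on the
  -- tail is needed.
  have hlt : min (ν * ρ + 1) 1 < 1 → ρ < 0 ∧ min (ν * ρ + 1) 1 = ν * ρ + 1 := by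
    intro hlt
    have h3 : ν * ρ + 1 < 1 := by simpa using hlt
    exact ⟨by nlinarith, min_eq_left h3.le⟩
  refine maxTestAttainsCriticalSparsity_of_bounds (le_min (by linarith) zero_le_one)
    (min_le_right _ _) (polynomial_tail_lower hg_meas hg_nonneg hG hν hσ h1.2)
    (fun hb => ?_) (fun hb => ?_)
  · rw [(hlt hb).2]
    exact polynomial_tail_upper hg_meas hG hν (hlt hb).1 hνρ hσ hA hC hbd
  · rw [(hlt hb).2]
    exact polynomial_likelihoodRatio_upper hg_meas hG hν (hlt hb).1 hνρ hσ hA hC hbd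

end PolynomialTail

end GlobalNull

theorem corollary1 (G : Measure ℝ) [IsProbabilityMeasure G] (g : ℝ → ℝ)
    (hg_meas : Measurable g) (hg_nonneg : ∀ θ, 0 ≤ g θ)
    (hG : G = volume.withDensity fun θ => ENNReal.ofReal (g θ)) :
    -- polynomial tail
    (∀ (ν ρ : ℝ) (σ : ℕ → ℝ), 0 < ν → -(2 * ν)⁻¹ < ρ →
      σ ~[atTop] (fun n : ℕ => (n : ℝ) ^ ρ) →
      g =Θ[atTop] (fun θ : ℝ => θ ^ (-ν - 1)) →
      (fun θ : ℝ => g (-θ)) =O[atTop] (fun θ : ℝ => θ ^ (-ν - 1)) →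
      GlobalNull.MaxTestAttainsCriticalSparsity (GlobalNull.scaleFamily G σ)
        (min (ν * ρ + 1) 1)) ∧
    -- exponential tail
    (∀ r : ℝ, √2 / (√2 - 1) < r →
      g =Θ[atTop] (fun θ : ℝ => Real.exp (-θ)) →
      (fun θ : ℝ => g (-θ)) =O[atTop] (fun θ : ℝ => Real.exp (-θ)) →
      GlobalNull.MaxTestAttainsCriticalSparsity
        (GlobalNull.scaleFamily G fun n : ℕ => r * (2 * Real.log n) ^ (-(1 / 2) : ℝ))
        ((1 - 1 / r) ^ 2)) ∧
    -- Gaussian tail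
    (∀ r γ γ' : ℝ, 1 < r →
      g =Θ[atTop] (fun θ : ℝ => Real.exp (-(θ - γ) ^ 2 / 2)) →
      (fun θ : ℝ => g (-θ)) =O[atTop] (fun θ : ℝ => Real.exp (-(θ - γ') ^ 2 / 2)) →
      GlobalNull.MaxTestAttainsCriticalSparsity (GlobalNull.scaleFamily G fun _ : ℕ => r)
        (r ^ 2 / (r ^ 2 + 1))) := by
  exact ⟨fun _ _ _ hν hρ hσ h1 h2 => GlobalNull.maxTestAttainsCriticalSparsity_polynomial hg_meas
      hg_nonneg hG hν hρ hσ h1 h2,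
    fun _ hr h1 h2 => GlobalNull.maxTestAttainsCriticalSparsity_exponential hg_meas hg_nonneg hG
      hr h1 h2,
    fun _ _ _ hr h1 h2 => GlobalNull.maxTestAttainsCriticalSparsity_gaussian hg_meas hg_nonneg hG
      hr h1 h2⟩
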